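/- Let $\tfrac12\le\eta\le1$ and let $\mathcal A(\rho)=K_0\rho K_0^\dagger+K_1\rho K_1^\dagger$ be the qubit amplitude damping channel with transmissivity $\eta$, where $K_0=|1\rangle\langle1|+\sqrt{\eta}\,|0\rangle\langle0|$ and $K_1=\sqrt{1-\eta}\,|1\rangle\langle0|$. For an ensemble $\{p_X(x),|\phi^x\rangle_{AA'}\}_x$ (finite alphabet, finite-dimensional reference system $A$, qubit input $A'$, unit vectors $|\phi^x\rangle$) put $$\rho_{XAB}=\sum_x p_X(x)\,|x\rangle\langle x|_X\otimes(\mathrm{id}_A\otimes\mathcal A_{A'\to B})\big(|\phi^x\rangle\langle\phi^x|_{AA'}\big),$$ and, with $H$ the von Neumann entropy in bits of the indicated reduced states of $\rho_{XAB}$, let $I(AX;B)=H(AX)+H(B)-H(ABX)$, $I(A\rangle BX)=H(BX)-H(ABX)$ and $I(X;B)=H(X)+H(B)-H(BX)$. The single-letter triple trade-off region of $\mathcal A$ is the union, over all such ensembles, of the polyhedra of $(C,Q,E)\in\mathbb R^3$ with $$C+2Q\le I(AX;B),\qquad Q+E\le I(A\rangle BX),\qquad C+Q+E\le I(X;B)+I(A\rangle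 BX).$$ Let $h_2(y)=-y\log_2y-(1-y)\log_2(1-y)$ and $$g(q,z,\nu)=h_2\!\left(\frac{1+\sqrt{(1-2zq)^2+4z\nu^2q(1-q)}}{2}\right).$$ Then the single-letter triple trade-off region of $\mathcal A$ equals the union over all $p,\nu\in[0,1]$ of the polyhedra of $(C,Q,E)\in\mathbb R^3$ with $$C+2Q\le h_2(\eta p)+g(p,1,\nu)-g(p,1-\eta,\nu),$$ $$Q+E\le g(p,\eta,\nu)-g(p,1-\eta,\nu),$$ $$C+Q+E\le h_2(\eta p)-g(p,1-\eta,\nu).$$ Moreover, it is achieved by the ensembles $$\tfrac12|0\rangle\langle0|_X\otimes\begin{pmatrix}1-p&\nu\sqrt{p(1-p)}\\ \nu\sqrt{p(1-p)}&p\end{pmatrix}_{A'}+\tfrac12|1\rangle\langle1|_X\otimes\begin{pmatrix}1-p&-\nu\sqrt{p(1-p)}\\ -\nu\sqrt{p(1-p)}&p\end{pmatrix}_{A'},\qquad p,\nu\in[0,1]$$ (matrices in the ordered basis $(|1\rangle,|0\rangle)$): for all $p,\nu\in[0,1]$ the two states have purifications with a common finite-dimensional reference system, for every such choice of purifications $|\phi^0\rangle,|\phi^1\rangle$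 the quantities $I(AX;B)$, $I(A\rangle BX)$ and $I(X;B)+I(A\rangle BX)$ equal the three right-hand sides above, respectively, and the region is the union over $p,\nu\in[0,1]$ of the polyhedra of these ensembles. -/

import Mathlib

open scoped Matrix Kronecker ComplexConjugate

noncomputable section

/-- Binary Shannon entropy in bits: `h₂(y) = -y log₂ y - (1-y) log₂ (1-y)`. -/
def h2 (y : ℝ) : ℝ := -y * Real.logb 2 y - (1 - y) * Real.logb 2 (1 - y)

/-- `g(q,z,ν) = h₂((1 + √((1-2zq)² + 4zν²q(1-q)))/2)`. -/
def gFun (q z ν : ℝ) : ℝ :=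
  h2 ((1 + Real.sqrt ((1 - 2 * z * q) ^ 2 + 4 * z * ν ^ 2 * q * (1 - q))) / 2)

open Classical in
/-- Von Neumann entropy in bits, `H(ρ) = -Tr(ρ log₂ ρ) = -∑ᵢ λᵢ log₂ λᵢ`, with `λᵢ` the
eigenvalues of the Hermitian matrix `ρ` (and `0` if `ρ` is not Hermitian, which never
happens for the density matrices below). -/
def vonNeumannEntropy {ι : Type} [Fintype ι] (ρ : Matrix ι ι ℂ) : ℝ :=
  if h : ρ.IsHermitian then
    -∑ i, h.eigenvalues i * Real.logb 2 (h.eigenvalues i)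
  else 0

/-- The linear map `ρ ↦ ∑ⱼ Kⱼ ρ Kⱼ†` given by a finite family of Kraus operators. -/
def krausMap {κ α β : Type} [Fintype κ] [Fintype α]
    (K : κ → Matrix β α ℂ) : Matrix α α ℂ →ₗ[ℂ] Matrix β β ℂ where
  toFun ρ := ∑ j, K j * ρ * (K j)ᴴ
  map_add' ρ σ := by simp [Matrix.mul_add, Matrix.add_mul, Finset.sum_add_distrib]
  map_smul' c ρ := by simp [Finset.smul_sum]

/-- Kraus operators of the qubit amplitude damping channel with transmissivity `η`:
`K₀ = |1⟩⟨1| + √η |0⟩⟨0|` and `K₁ = √(1-η) |1⟩⟨0|`.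
The matrix index `k : Fin 2` stands for the basis ket `|k⟩`. -/
def amplitudeDampingKraus (η : ℝ) : Fin 2 → Matrix (Fin 2) (Fin 2) ℂ :=
  ![Matrix.single 1 1 1 + Matrix.single 0 0 ((Real.sqrt η : ℝ) : ℂ),
    Matrix.single 1 0 ((Real.sqrt (1 - η) : ℝ) : ℂ)]

/-- The qubit amplitude damping channel with transmissivity `η`. -/
def amplitudeDamping (η : ℝ) : Matrix (Fin 2) (Fin 2) ℂ →ₗ[ℂ] Matrix (Fin 2) (Fin 2) ℂ :=
  krausMap (amplitudeDampingKraus η)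

/-- `id_A ⊗ N`, acting on operators on `A ⊗ A'`: apply `N` to every `A'`-block. -/
def idTensor {A α β : Type} (N : Matrix α α ℂ →ₗ[ℂ] Matrix β β ℂ)
    (σ : Matrix (A × α) (A × α) ℂ) : Matrix (A × β) (A × β) ℂ :=
  Matrix.of fun s t => N (Matrix.of fun i j => σ (s.1, i) (t.1, j)) s.2 t.2

/-- An ensemble `{p_X(x), |φˣ⟩_{AA'}}` of pure bipartite states: a probability distribution on the
finite alphabet `X` and, for each letter, a unit vector of `ℂ^A ⊗ ℂ^α`, where `α` indexes a basis
of the channel input `A'` and `A` a basis of the reference system. -/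
structure PureEnsemble (X A α : Type) [Fintype X] [Fintype A] [Fintype α] where
  prob : X → ℝ
  prob_nonneg : ∀ x, 0 ≤ prob x
  prob_sum : ∑ x, prob x = 1
  vec : X → A × α → ℂ
  vec_norm : ∀ x, ∑ s, ‖vec x s‖ ^ 2 = 1

namespace PureEnsemble

variable {X A α : Type} [Fintype X] [Fintype A] [Fintype α]

/-- The rank-one projection `|φˣ⟩⟨φˣ|` on `A ⊗ A'`. -/
def proj (e : PureEnsemble X A α) (x : X) : Matrix (A × α) (A × α) ℂ :=
  Matrix.vecMulVec (e.vec x) (star (e.vec x))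

/-- The channel input state `ρˣ_{A'} = Tr_A |φˣ⟩⟨φˣ|`, of which `|φˣ⟩` is a purification. -/
def inputState (e : PureEnsemble X A α) (x : X) : Matrix α α ℂ :=
  Matrix.of fun i j => ∑ a, e.proj x (a, i) (a, j)

open Classical in
/-- The classical-quantum state
`ρ_{XAB} = ∑ₓ p_X(x) |x⟩⟨x|_X ⊗ (id_A ⊗ N_{A'→B})(|φˣ⟩⟨φˣ|_{AA'})`. -/
def cqState {β : Type} (e : PureEnsemble X A α) (N : Matrix α α ℂ →ₗ[ℂ] Matrix β β ℂ) :
    Matrix (X × A × β) (X × A × β) ℂ :=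
  ∑ x, (e.prob x : ℂ) • (Matrix.single x x (1 : ℂ) ⊗ₖ idTensor N (e.proj x))

end PureEnsemble

section Marginals

variable {X A B : Type} [Fintype X] [Fintype A] [Fintype B]

/-- Reduced state on `X`. -/
def margX (ρ : Matrix (X × A × B) (X × A × B) ℂ) : Matrix X X ℂ :=
  Matrix.of fun x x' => ∑ a, ∑ b, ρ (x, a, b) (x', a, b)

/-- Reduced state on `B`. -/
def margB (ρ : Matrix (X × A × B) (X × A × B) ℂ) : Matrix B B ℂ :=
  Matrix.of fun b b' => ∑ x, ∑ a, ρ (x, a, b) (x, a, b')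

/-- Reduced state on `AX`. -/
def margAX (ρ : Matrix (X × A × B) (X × A × B) ℂ) : Matrix (X × A) (X × A) ℂ :=
  Matrix.of fun s t => ∑ b, ρ (s.1, s.2, b) (t.1, t.2, b)

/-- Reduced state on `BX`. -/
def margBX (ρ : Matrix (X × A × B) (X × A × B) ℂ) : Matrix (X × B) (X × B) ℂ :=
  Matrix.of fun s t => ∑ a, ρ (s.1, a, s.2) (t.1, a, t.2)

/-- Quantum mutual information `I(AX;B) = H(AX) + H(B) - H(ABX)`. -/
def mutualInfoAXB (ρ : Matrix (X × A × B) (X × A × B) ℂ) : ℝ :=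
  vonNeumannEntropy (margAX ρ) + vonNeumannEntropy (margB ρ) - vonNeumannEntropy ρ

/-- Coherent information `I(A⟩BX) = H(BX) - H(ABX)`. -/
def coherentInfo (ρ : Matrix (X × A × B) (X × A × B) ℂ) : ℝ :=
  vonNeumannEntropy (margBX ρ) - vonNeumannEntropy ρ

/-- Holevo information `I(X;B) = H(X) + H(B) - H(BX)`. -/
def holevoInfo (ρ : Matrix (X × A × B) (X × A × B) ℂ) : ℝ :=
  vonNeumannEntropy (margX ρ) + vonNeumannEntropy (margB ρ) - vonNeumannEntropy (margBX ρ)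

end Marginals

/-- The polyhedron of rate triples `(C, Q, E)` with
`C + 2Q ≤ a`, `Q + E ≤ b`, `C + Q + E ≤ c`. -/
def ratePolyhedron (a b c : ℝ) : Set (ℝ × ℝ × ℝ) :=
  {r | r.1 + 2 * r.2.1 ≤ a ∧ r.2.1 + r.2.2 ≤ b ∧ r.1 + r.2.1 + r.2.2 ≤ c}

/-- The polyhedron of an ensemble used over the channel `N`:
`C + 2Q ≤ I(AX;B)`, `Q + E ≤ I(A⟩BX)`, `C + Q + E ≤ I(X;B) + I(A⟩BX)`. -/
def PureEnsemble.polyhedron {X A α β : Type} [Fintype X] [Fintype A] [Fintype α] [Fintype β]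
    (e : PureEnsemble X A α) (N : Matrix α α ℂ →ₗ[ℂ] Matrix β β ℂ) : Set (ℝ × ℝ × ℝ) :=
  ratePolyhedron (mutualInfoAXB (e.cqState N)) (coherentInfo (e.cqState N))
    (holevoInfo (e.cqState N) + coherentInfo (e.cqState N))

/-- The single-letter triple trade-off region of `N`: the union of the polyhedra of all ensembles,
over all finite alphabets and all finite-dimensional reference systems. -/
def tripleTradeoffRegion {α β : Type} [Fintype α] [Fintype β]
    (N : Matrix α α ℂ →ₗ[ℂ] Matrix β β ℂ) : Set (ℝ × ℝ × ℝ) :=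
  ⋃ (n : ℕ) (d : ℕ) (e : PureEnsemble (Fin n) (Fin d) α), e.polyhedron N

/-- The qubit state with `⟨0|ρ|0⟩ = p`, `⟨1|ρ|1⟩ = 1 - p` and `⟨0|ρ|1⟩ = ⟨1|ρ|0⟩ = c`; in the
ordered basis `(|1⟩, |0⟩)` it reads `(1-p, c; c, p)`. -/
def qubitState (p c : ℝ) : Matrix (Fin 2) (Fin 2) ℂ :=
  !![(p : ℂ), (c : ℂ); (c : ℂ), ((1 - p : ℝ) : ℂ)]

/-- `e` is (a purification of) the symmetric ensemble
`½ |0⟩⟨0|_X ⊗ ρ₊ + ½ |1⟩⟨1|_X ⊗ ρ₋`, where `ρ_±` has populations `p`, `1 - p` and coherence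
`±ν √(p(1-p))`. -/
def PureEnsemble.IsSymmetric {A : Type} [Fintype A] (e : PureEnsemble (Fin 2) A (Fin 2))
    (p ν : ℝ) : Prop :=
  (∀ x, e.prob x = 1 / 2) ∧
  e.inputState 0 = qubitState p (ν * Real.sqrt (p * (1 - p))) ∧
  e.inputState 1 = qubitState p (-(ν * Real.sqrt (p * (1 - p))))

end

/-! The entropy of a qubit state is a function `qubitEnt` of four times its determinant, and the
environment of the channel A_η receives A_{1-η}(ρ) up to a change of basis and a transpose. Hence
the three informations of an ensemble are built from the entropy of the mean output and the average
entropies of A_z(ρˣ) at the levels z = 1, η, 1-η, and each of them subtracts the average at 1-η.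

Given an ensemble with mean population p, choose ν so that the symmetric ensemble with parameters p,
ν has the same average entropy at level 1-η. It remains to see that nothing else decreases. The
entropy of the mean output is at most h₂(ηp), with equality for the symmetric ensemble because its
coherences cancel. For the levels z = 1 and z = η, note that A_{1-η} = A_s ∘ A_z with s = (1-η)/z,
and s ≤ 1 because η ≥ 1/2. By `qubitEnt_damping_le_sum`, replacing the states at level z by a single
population and entropy, namely their averages, cannot increase the entropy after A_s. So an ensemble
with more entropy than the symmetric one at level z would also have more at level 1-η, contrary to
the choice of ν (`exists_coherence`).

This Jensen inequality is the joint convexity of the output entropy in the population and entropy of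
the input (`convexOn_qubitEnt_damping`). Computing the second derivative along a segment and
applying Cauchy-Schwarz reduces convexity to `qubitEntRatio_damping`, an inequality between the
ratios of first to second derivatives of `qubitEnt` at input and output. That in turn follows from
two facts about `entCurv`: it decreases in r, while its quotient by 1 - r increases. -/

/-! ### Monotone quotients of hyperbolic functions -/

/-- Monotone form of l'Hôpital's rule. -/
theorem monotoneOn_div_of_hasDerivAt {f g f' g' k : ℝ → ℝ}
    (hf : ∀ x, HasDerivAt f (f' x) x) (hg : ∀ x, HasDerivAt g (g' x) x)
    (hf0 : f 0 = 0) (hg0 : g 0 = 0) (hg' : ∀ x, 0 < x → 0 < g' x)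
    (hk : ∀ x, 0 < x → f' x = k x * g' x) (hkm : MonotoneOn k (Set.Ioi 0)) :
    (∀ x, 0 < x → 0 < g x) ∧ MonotoneOn (fun x => f x / g x) (Set.Ioi 0) := by
  -- Cauchy's mean value theorem, with the quotient of the derivatives written as `k`.
  have key : ∀ a b, 0 ≤ a → a < b → ∃ c ∈ Set.Ioo a b, (g b - g a) * k c = f b - f a := by
    intro a b ha hab
    obtain ⟨c, hc, h⟩ := exists_ratio_hasDerivAt_eq_ratio_slope f f' hab
      (fun x _ => (hf x).continuousAt.continuousWithinAt) (fun x _ => hf x) g g'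
      (fun x _ => (hg x).continuousAt.continuousWithinAt) (fun x _ => hg x)
    have hc0 : 0 < c := lt_of_le_of_lt ha hc.1
    refine ⟨c, hc, mul_right_cancel₀ (hg' c hc0).ne' ?_⟩
    rw [← h, hk c hc0]; ring
  have hmono : StrictMonoOn g (Set.Ici 0) := by
    apply strictMonoOn_of_deriv_pos (convex_Ici 0)
      (fun x _ => (hg x).continuousAt.continuousWithinAt)
    intro x hx
    rw [interior_Ici] at hx
    rw [(hg x).deriv]; exact hg' x hx
  have hpos : ∀ x, 0 < x → 0 < g x := fun x hx => by
    have := hmono (Set.self_mem_Ici) (Set.mem_Ici.2 hx.le) hx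
    rwa [hg0] at this
  refine ⟨hpos, ?_⟩
  intro x hx y hy hxy
  rcases hxy.eq_or_lt with rfl | hlt
  · exact le_rfl
  have hx : 0 < x := hx
  have hy : 0 < y := hy
  obtain ⟨c, hc, h1⟩ := key 0 x le_rfl hx
  obtain ⟨d, hd, h2⟩ := key x y hx.le hlt
  rw [hf0, hg0, sub_zero, sub_zero] at h1
  have hcx : k c ≤ k x := hkm (Set.mem_Ioi.2 hc.1) (Set.mem_Ioi.2 hx) hc.2.le
  have hxd : k x ≤ k d := hkm (Set.mem_Ioi.2 hx) (Set.mem_Ioi.2 (hx.trans hd.1)) hd.1.le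
  have hgx := hpos x hx
  have hgy := hpos y hy
  have hgxy : 0 < g y - g x := sub_pos.2 (hmono (Set.mem_Ici.2 hx.le) (Set.mem_Ici.2 hy.le) hlt)
  show f x / g x ≤ f y / g y
  rw [div_le_div_iff₀ hgx hgy]
  -- The ratio at `y` is a weighted mean of `k c`, which is the ratio at `x`, and the larger value
  -- `k d`.
  have e1 : f y = g x * k c + (g y - g x) * k d := by linarith
  rw [e1, ← h1]
  have : 0 ≤ (g y - g x) * (k d - k c) * g x :=
    mul_nonneg (mul_nonneg hgxy.le (by linarith)) hgx.le
  nlinarith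

theorem Real.hasDerivAt_tanh (x : ℝ) : HasDerivAt Real.tanh (1 - Real.tanh x ^ 2) x := by
  have h := (Real.hasDerivAt_sinh x).div (Real.hasDerivAt_cosh x) (Real.cosh_pos x).ne'
  have e : Real.tanh = fun y => Real.sinh y / Real.cosh y := funext Real.tanh_eq_sinh_div_cosh
  rw [e]
  refine h.congr_deriv ?_
  have := (Real.cosh_pos x).ne'
  field_simp

theorem hasDerivAt_sinh_two_mul_sub (x : ℝ) :
    HasDerivAt (fun x => Real.sinh (2 * x) - 2 * x) (2 * Real.cosh (2 * x) - 2) x := by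
  have h := ((hasDerivAt_id x).const_mul 2)
  have h2 := (h.sinh).sub h
  refine h2.congr_deriv ?_
  simp; ring

theorem two_mul_cosh_two_mul_sub (x : ℝ) :
    2 * Real.cosh (2 * x) - 2 = 4 * Real.sinh x ^ 2 := by
  rw [Real.cosh_two_mul, Real.cosh_sq]; ring

/-- The derivatives are tanh² x and 4 sinh² x, with decreasing ratio 1 / (4 cosh² x). The rule for
increasing quotients is applied to the negated numerator. -/
theorem antitoneOn_sub_tanh_div :
    (∀ x, 0 < x → 0 < Real.sinh (2 * x) - 2 * x) ∧
    AntitoneOn (fun x => (x - Real.tanh x) / (Real.sinh (2 * x) - 2 * x)) (Set.Ioi 0) := by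
  have h := monotoneOn_div_of_hasDerivAt (f := fun x => Real.tanh x - x)
    (g := fun x => Real.sinh (2 * x) - 2 * x) (f' := fun x => 1 - Real.tanh x ^ 2 - 1)
    (k := fun x => - (1 / (4 * Real.cosh x ^ 2)))
    (fun x => (Real.hasDerivAt_tanh x).sub (hasDerivAt_id x)) hasDerivAt_sinh_two_mul_sub
    (by simp) (by simp)
    (fun x hx => by
      rw [two_mul_cosh_two_mul_sub]
      have := Real.sinh_pos_iff.2 hx
      positivity)
    (fun x hx => by
      rw [two_mul_cosh_two_mul_sub, Real.tanh_eq_sinh_div_cosh]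
      have := (Real.cosh_pos x).ne'
      field_simp
      ring)
    (by
      intro x hx y hy hxy
      have hx : 0 < x := hx
      have hc : Real.cosh x ≤ Real.cosh y := by
        rw [Real.cosh_le_cosh, abs_of_pos hx, abs_of_pos (hx.trans_le hxy)]; exact hxy
      have := Real.cosh_pos x
      show - (1 / (4 * Real.cosh x ^ 2)) ≤ - (1 / (4 * Real.cosh y ^ 2))
      rw [neg_le_neg_iff]
      gcongr)
  refine ⟨h.1, fun x hx y hy hxy => ?_⟩
  have := h.2 hx hy hxy
  simp only at this ⊢
  rw [← neg_sub y, ← neg_sub x, neg_div, neg_div] at this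
  linarith

/-- The quotient equals 4x / (1 - exp(-4x)), whose ratio of derivatives is exp(4x). -/
theorem monotoneOn_mul_exp_div_sinh :
    MonotoneOn (fun x => 2 * x * Real.exp (2 * x) / Real.sinh (2 * x)) (Set.Ioi 0) := by
  have hd : ∀ x : ℝ, HasDerivAt (fun x => 1 - Real.exp (-4 * x)) (4 * Real.exp (-4 * x)) x := by
    intro x
    have := (((hasDerivAt_id x).const_mul (-4)).exp).const_sub 1
    refine this.congr_deriv ?_
    simp; ring
  have h := monotoneOn_div_of_hasDerivAt (f := fun x => 4 * x)
    (g := fun x => 1 - Real.exp (-4 * x)) (f' := fun _ => 4)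
    (k := fun x => Real.exp (4 * x))
    (fun x => by simpa using (hasDerivAt_id x).const_mul 4) hd
    (by simp) (by simp) (fun x _ => by positivity)
    (fun x _ => by
      have : Real.exp (4 * x) * Real.exp (-4 * x) = 1 := by
        rw [← Real.exp_add]; simp
      linarith)
    (by
      intro x _ y _ hxy
      exact Real.exp_le_exp.2 (by linarith))
  refine h.2.congr ?_
  intro x hx
  have hx : 0 < x := hx
  have h1 := h.1 x hx
  have h2 : 0 < Real.sinh (2 * x) := Real.sinh_pos_iff.2 (by linarith)
  simp only
  rw [div_eq_div_iff h1.ne' h2.ne', Real.sinh_eq]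
  have e1 : Real.exp (2 * x) * Real.exp (-4 * x) = Real.exp (-(2 * x)) := by
    rw [← Real.exp_add]; congr 1; ring
  linear_combination (2 * x) * e1

/-- Two applications of the rule: numerator and denominator both vanish to second order at 0, and
the ratio of second derivatives is half the function of `monotoneOn_mul_exp_div_sinh`. -/
theorem monotoneOn_exp_div_sinh_sub :
    MonotoneOn (fun x => (x * (Real.exp (2 * x) + 1) - Real.exp (2 * x) + 1) /
      (Real.sinh (2 * x) - 2 * x)) (Set.Ioi 0) := by
  have he : ∀ x : ℝ, HasDerivAt (fun x => Real.exp (2 * x)) (2 * Real.exp (2 * x)) x := by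
    intro x
    have := ((hasDerivAt_id x).const_mul 2).exp
    refine this.congr_deriv ?_
    simp; ring
  have h1 := monotoneOn_div_of_hasDerivAt (f := fun x => 1 + (2 * x - 1) * Real.exp (2 * x))
    (g := fun x => 2 * Real.cosh (2 * x) - 2) (f' := fun x => 4 * x * Real.exp (2 * x))
    (g' := fun x => 4 * Real.sinh (2 * x))
    (k := fun x => (1 / 2) * (2 * x * Real.exp (2 * x) / Real.sinh (2 * x)))
    (fun x => by
      have := ((((hasDerivAt_id x).const_mul 2).sub_const 1).mul (he x)).const_add 1
      refine this.congr_deriv ?_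
      simp; ring)
    (fun x => by
      have := ((((hasDerivAt_id x).const_mul 2).cosh).const_mul 2).sub_const 2
      refine this.congr_deriv ?_
      simp; ring)
    (by simp) (by simp)
    (fun x hx => by
      have := Real.sinh_pos_iff.2 (show 0 < 2 * x by linarith)
      positivity)
    (fun x hx => by
      have := (Real.sinh_pos_iff.2 (show 0 < 2 * x by linarith)).ne'
      field_simp)
    (fun x hx y hy hxy => mul_le_mul_of_nonneg_left (monotoneOn_mul_exp_div_sinh hx hy hxy)
      (by norm_num))
  have h2 := monotoneOn_div_of_hasDerivAt
    (f := fun x => x * (Real.exp (2 * x) + 1) - Real.exp (2 * x) + 1)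
    (g := fun x => Real.sinh (2 * x) - 2 * x)
    (f' := fun x => 1 + (2 * x - 1) * Real.exp (2 * x))
    (fun x => by
      have := (((hasDerivAt_id x).mul ((he x).add_const 1)).sub (he x)).add_const 1
      refine this.congr_deriv ?_
      simp; ring)
    hasDerivAt_sinh_two_mul_sub (by simp) (by simp) h1.1
    (fun x hx => (div_mul_cancel₀ _ (h1.1 x hx).ne').symm)
    h1.2
  exact h2.2

/-! ### The curvature function `entCurv` -/

/-- The function `θ - 2y` at `y = 1 - r²`, where `-θ` is the ratio of the first to the second
derivative of `qubitEnt`. -/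
noncomputable def entCurv (r : ℝ) : ℝ :=
  2 * (1 - r ^ 2) * (Real.artanh r - r) / (r - (1 - r ^ 2) * Real.artanh r)

theorem tanh_sinh_identity (x : ℝ) :
    Real.cosh x ^ 2 * (Real.tanh x - (1 - Real.tanh x ^ 2) * x) =
      (Real.sinh (2 * x) - 2 * x) / 2 := by
  rw [Real.tanh_eq_sinh_div_cosh, Real.sinh_two_mul]
  have := (Real.cosh_pos x).ne'
  field_simp
  rw [Real.cosh_sq]; ring

/-- The substitution r = tanh x removes `artanh` and gives the quotients treated above; the
denominators match after multiplication by cosh² x. -/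
theorem entCurv_tanh {x : ℝ} (hx : 0 < x) :
    entCurv (Real.tanh x) = 4 * ((x - Real.tanh x) / (Real.sinh (2 * x) - 2 * x)) := by
  have h := antitoneOn_sub_tanh_div.1 x hx
  have h1 := tanh_sinh_identity x
  have hc := Real.cosh_pos x
  have hd : 0 < Real.tanh x - (1 - Real.tanh x ^ 2) * x := by
    have : 0 < Real.cosh x ^ 2 * (Real.tanh x - (1 - Real.tanh x ^ 2) * x) := by
      rw [h1]; linarith
    exact pos_of_mul_pos_right this (by positivity)
  have h2 : Real.cosh x ^ 2 * (1 - Real.tanh x ^ 2) = 1 := by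
    rw [Real.tanh_eq_sinh_div_cosh]
    field_simp
    rw [Real.cosh_sq]; ring
  rw [entCurv, Real.artanh_tanh, ← mul_div_assoc, div_eq_div_iff hd.ne' h.ne']
  have h3 : Real.sinh (2 * x) - 2 * x =
      2 * (Real.cosh x ^ 2 * (Real.tanh x - (1 - Real.tanh x ^ 2) * x)) := by linarith
  rw [h3]
  linear_combination (4 * (x - Real.tanh x) * (Real.tanh x - (1 - Real.tanh x ^ 2) * x)) * h2

theorem exists_tanh_eq {r : ℝ} (h0 : 0 < r) (h1 : r < 1) : ∃ x, 0 < x ∧ Real.tanh x = r :=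
  ⟨Real.artanh r, Real.artanh_pos ⟨h0, h1⟩, Real.tanh_artanh ⟨by linarith, h1⟩⟩

theorem le_of_tanh_le_tanh {x y : ℝ} (h : Real.tanh x ≤ Real.tanh y) : x ≤ y := by
  have hx := Real.artanh_le_artanh (Real.neg_one_lt_tanh x) (Real.tanh_lt_one y) h
  simpa [Real.artanh_tanh] using hx

theorem sub_mul_artanh_pos {r : ℝ} (h0 : 0 < r) (h1 : r < 1) :
    0 < r - (1 - r ^ 2) * Real.artanh r := by
  obtain ⟨x, hx, rfl⟩ := exists_tanh_eq h0 h1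
  rw [Real.artanh_tanh]
  have h := antitoneOn_sub_tanh_div.1 x hx
  have h2 : 0 < Real.cosh x ^ 2 * (Real.tanh x - (1 - Real.tanh x ^ 2) * x) := by
    rw [tanh_sinh_identity x]; linarith
  exact pos_of_mul_pos_right h2 (by positivity)

theorem entCurv_antitone {r r' : ℝ} (h0 : 0 < r) (hr : r ≤ r') (h1 : r' < 1) :
    entCurv r' ≤ entCurv r := by
  obtain ⟨x, hx, rfl⟩ := exists_tanh_eq h0 (hr.trans_lt h1)
  obtain ⟨y, hy, rfl⟩ := exists_tanh_eq (h0.trans_le hr) h1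
  rw [entCurv_tanh hx, entCurv_tanh hy]
  have := antitoneOn_sub_tanh_div.2 (Set.mem_Ioi.2 hx) (Set.mem_Ioi.2 hy) (le_of_tanh_le_tanh hr)
  simp only at this
  linarith

theorem entCurv_div_monotone {r r' : ℝ} (h0 : 0 < r) (hr : r ≤ r') (h1 : r' < 1) :
    entCurv r / (1 - r) ≤ entCurv r' / (1 - r') := by
  have key : ∀ x, 0 < x → entCurv (Real.tanh x) / (1 - Real.tanh x) =
      2 * ((x * (Real.exp (2 * x) + 1) - Real.exp (2 * x) + 1) /
      (Real.sinh (2 * x) - 2 * x)) := by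
    intro x hx
    rw [entCurv_tanh hx]
    have h := antitoneOn_sub_tanh_div.1 x hx
    have h1 : 0 < 1 - Real.tanh x := sub_pos.2 (Real.tanh_lt_one x)
    have h2 : Real.tanh x * (Real.exp (2 * x) + 1) = Real.exp (2 * x) - 1 := by
      have e : Real.exp (2 * x) = Real.exp x * Real.exp x := by rw [← Real.exp_add]; ring_nf
      rw [Real.tanh_eq_sinh_div_cosh, Real.sinh_eq, Real.cosh_eq, e, Real.exp_neg]
      have := Real.exp_pos x
      field_simp
    rw [← mul_div_assoc, ← mul_div_assoc, div_div, div_eq_div_iff (by positivity) h.ne']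
    have h3 : (x * (Real.exp (2 * x) + 1) - Real.exp (2 * x) + 1) * (1 - Real.tanh x) =
        2 * (x - Real.tanh x) := by
      linear_combination (1 - x) * h2
    linear_combination (-2 * (Real.sinh (2 * x) - 2 * x)) * h3
  obtain ⟨x, hx, rfl⟩ := exists_tanh_eq h0 (hr.trans_lt h1)
  obtain ⟨y, hy, rfl⟩ := exists_tanh_eq (h0.trans_le hr) h1
  rw [key x hx, key y hy]
  have := monotoneOn_exp_div_sinh_sub (Set.mem_Ioi.2 hx) (Set.mem_Ioi.2 hy) (le_of_tanh_le_tanh hr)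
  simp only at this
  linarith

/-- With R = 1 - s(1 - r) one has 1 - R = s(1 - r), so monotonicity of `entCurv r / (1 - r)` from r
to R produces exactly the factor s. Antitonicity then passes from R down to r'. -/
theorem mul_entCurv_le {r r' s : ℝ} (hr0 : 0 < r) (hr1 : r < 1) (hs0 : 0 < s) (hs1 : s ≤ 1)
    (hr'0 : 0 < r') (hr' : r' ≤ 1 - s * (1 - r)) : s * entCurv r ≤ entCurv r' := by
  have hlt : 1 - s * (1 - r) < 1 := by nlinarith
  have hle : r ≤ 1 - s * (1 - r) := by nlinarith
  refine le_trans ?_ (entCurv_antitone hr'0 hr' hlt)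
  have := entCurv_div_monotone hr0 hle hlt
  rw [div_le_div_iff₀ (by linarith) (by linarith)] at this
  have h1 : 0 < 1 - r := by linarith
  have h2 : (s * entCurv r) * (1 - r) ≤ entCurv (1 - s * (1 - r)) * (1 - r) := by linarith
  exact le_of_mul_le_mul_right h2 h1

/-! ### Qubit entropy as a function of the determinant -/

/-- Entropy, in nats, of a qubit state whose determinant is `y / 4`. -/
noncomputable def qubitEnt (y : ℝ) : ℝ := Real.binEntropy ((1 + √(1 - y)) / 2)

/-- The derivative of `qubitEnt` on `(0, 1)`. -/
noncomputable def qubitEntDeriv (y : ℝ) : ℝ := Real.artanh √(1 - y) / (2 * √(1 - y))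

/-- Minus the ratio of the first to the second derivative of `qubitEnt` on `(0, 1)`. -/
noncomputable def qubitEntRatio (y : ℝ) : ℝ := entCurv √(1 - y) + 2 * y

theorem continuous_qubitEnt : Continuous qubitEnt := by
  unfold qubitEnt; fun_prop

theorem qubitEnt_zero : qubitEnt 0 = 0 := by simp [qubitEnt]

theorem qubitEnt_one : qubitEnt 1 = Real.log 2 := by
  simp [qubitEnt]

/-- The case of a diagonal state, with eigenvalues q and 1 - q. -/
theorem qubitEnt_four_mul (q : ℝ) : qubitEnt (4 * q * (1 - q)) = Real.binEntropy q := by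
  have e : 1 - 4 * q * (1 - q) = (2 * q - 1) ^ 2 := by ring
  rw [qubitEnt, e, Real.sqrt_sq_eq_abs]
  rcases abs_cases (2 * q - 1) with h | h
  · rw [h.1]; congr 1; ring
  · rw [h.1, ← Real.binEntropy_one_sub]; congr 1; ring

theorem strictMonoOn_qubitEnt : StrictMonoOn qubitEnt (Set.Icc 0 1) := by
  intro x hx y hy hxy
  have hs : √(1 - y) < √(1 - x) := Real.sqrt_lt_sqrt (by linarith [hy.2]) (by linarith)
  have h1 : √(1 - x) ≤ 1 := Real.sqrt_le_one.2 (by linarith [hx.1])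
  have h0 := Real.sqrt_nonneg (1 - y)
  apply Real.binEntropy_strictAntiOn
  · constructor <;> norm_num <;> linarith
  · constructor <;> norm_num <;> linarith
  · linarith

theorem monotoneOn_qubitEnt : MonotoneOn qubitEnt (Set.Icc 0 1) := strictMonoOn_qubitEnt.monotoneOn

theorem qubitEnt_nonneg {y : ℝ} (h0 : 0 ≤ y) (h1 : y ≤ 1) : 0 ≤ qubitEnt y := by
  rw [← qubitEnt_zero]; exact monotoneOn_qubitEnt ⟨le_rfl, zero_le_one⟩ ⟨h0, h1⟩ h0

theorem Real.hasDerivAt_artanh {r : ℝ} (h0 : -1 < r) (h1 : r < 1) :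
    HasDerivAt Real.artanh (1 - r ^ 2)⁻¹ r := by
  have hd : HasDerivAt (fun r => 1 / 2 * Real.log ((1 + r) / (1 - r))) (1 - r ^ 2)⁻¹ r := by
    have h1' : 1 - r ≠ 0 := by linarith
    have h0' : 1 + r ≠ 0 := by linarith
    have h := ((((hasDerivAt_id r).const_add 1).div ((hasDerivAt_id r).const_sub 1)
      h1').log (div_ne_zero h0' h1')).const_mul (1 / 2)
    refine h.congr_deriv ?_
    have : 1 - r ^ 2 ≠ 0 := by
      rw [show 1 - r ^ 2 = (1 - r) * (1 + r) by ring]; exact mul_ne_zero h1' h0'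
    simp only [id, Pi.div_apply]
    field_simp
    ring
  refine hd.congr_of_eventuallyEq ?_
  filter_upwards [Icc_mem_nhds h0 h1] with x hx
  exact Real.artanh_eq_half_log hx

theorem sqrt_one_sub_mem {y : ℝ} (h0 : 0 < y) (h1 : y < 1) :
    0 < √(1 - y) ∧ √(1 - y) < 1 ∧ √(1 - y) ^ 2 = 1 - y :=
  ⟨Real.sqrt_pos.2 (by linarith), by rw [Real.sqrt_lt' one_pos]; linarith,
    Real.sq_sqrt (by linarith)⟩

theorem hasDerivAt_sqrt_one_sub {y : ℝ} (h1 : y < 1) : HasDerivAt (fun y => √(1 - y)) (-1 / (2 * √(1 - y))) y :=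
  ((hasDerivAt_id y).const_sub 1).sqrt (by simp; linarith)

theorem hasDerivAt_qubitEnt {y : ℝ} (h0 : 0 < y) (h1 : y < 1) :
    HasDerivAt qubitEnt (qubitEntDeriv y) y := by
  obtain ⟨hr0, hr1, hr2⟩ := sqrt_one_sub_mem h0 h1
  have h := (Real.hasDerivAt_binEntropy (p := (1 + √(1 - y)) / 2) (by positivity)
    (by linarith)).comp y (((hasDerivAt_sqrt_one_sub h1).const_add 1).div_const 2)
  refine h.congr_deriv ?_
  rw [qubitEntDeriv, Real.artanh_eq_half_log ⟨by linarith, hr1.le⟩,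
    Real.log_div (by linarith) (sub_pos.2 hr1).ne',
    show 1 - (1 + √(1 - y)) / 2 = (1 - √(1 - y)) / 2 by ring,
    Real.log_div (sub_pos.2 hr1).ne' (by norm_num), Real.log_div (by linarith) (by norm_num)]
  field_simp
  ring

theorem qubitEntDeriv_pos {y : ℝ} (h0 : 0 < y) (h1 : y < 1) :
    0 < qubitEntDeriv y := by
  obtain ⟨hr0, hr1, hr2⟩ := sqrt_one_sub_mem h0 h1
  have := Real.artanh_pos ⟨hr0, hr1⟩
  unfold qubitEntDeriv; positivity

theorem qubitEntRatio_eq {y : ℝ} (h0 : 0 < y) (h1 : y < 1) :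
    qubitEntRatio y = 2 * Real.artanh √(1 - y) * √(1 - y) ^ 2 * y /
    (√(1 - y) - y * Real.artanh √(1 - y)) := by
  obtain ⟨hr0, hr1, hr2⟩ := sqrt_one_sub_mem h0 h1
  have h := sub_mul_artanh_pos hr0 hr1
  have e : 1 - √(1 - y) ^ 2 = y := by rw [hr2]; ring
  rw [qubitEntRatio, entCurv]
  rw [e] at h ⊢
  rw [div_add' _ _ _ h.ne']
  congr 1
  rw [hr2]; ring

theorem qubitEntRatio_pos {y : ℝ} (h0 : 0 < y) (h1 : y < 1) :
    0 < qubitEntRatio y := by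
  obtain ⟨hr0, hr1, hr2⟩ := sqrt_one_sub_mem h0 h1
  have h := sub_mul_artanh_pos hr0 hr1
  have e : 1 - √(1 - y) ^ 2 = y := by rw [hr2]; ring
  rw [e] at h
  rw [qubitEntRatio_eq h0 h1]
  have := Real.artanh_pos ⟨hr0, hr1⟩
  positivity

theorem hasDerivAt_qubitEntDeriv {y : ℝ} (h0 : 0 < y) (h1 : y < 1) :
    HasDerivAt qubitEntDeriv (-(qubitEntDeriv y / qubitEntRatio y)) y := by
  obtain ⟨hr0, hr1, hr2⟩ := sqrt_one_sub_mem h0 h1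
  have hs := hasDerivAt_sqrt_one_sub h1
  have h := ((Real.hasDerivAt_artanh (by linarith) hr1).comp y hs).div (hs.const_mul 2)
    (by positivity)
  refine h.congr_deriv ?_
  have hp := sub_mul_artanh_pos hr0 hr1
  have e : 1 - √(1 - y) ^ 2 = y := by rw [hr2]; ring
  rw [e] at hp
  have ha := Real.artanh_pos ⟨hr0, hr1⟩
  rw [qubitEntRatio_eq h0 h1, qubitEntDeriv, e]
  simp only [Function.comp]
  field_simp
  ring

/-- The inequality between the curvature ratios of the input and of the output of an amplitude
damping channel with transmissivity `s`. -/
theorem qubitEntRatio_damping {y s P : ℝ} (hy0 : 0 < y) (hy1 : y < 1) (hs0 : 0 < s) (hs1 : s ≤ 1)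
    (hP : (1 - 2 * P) ^ 2 ≤ 1 - y) (hz : s * y + 4 * s * (1 - s) * P ^ 2 < 1) :
    s * qubitEntRatio y + 8 * s * (1 - s) * P ^ 2 ≤
      qubitEntRatio (s * y + 4 * s * (1 - s) * P ^ 2) := by
  have hs1' : 0 ≤ 1 - s := by linarith
  have hz0 : 0 < s * y + 4 * s * (1 - s) * P ^ 2 := by positivity
  obtain ⟨hr0, hr1, hr2⟩ := sqrt_one_sub_mem hy0 hy1
  obtain ⟨hq0, hq1, hq2⟩ := sqrt_one_sub_mem hz0 hz
  -- The population is at least the smaller eigenvalue (1 - √(1 - y)) / 2.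
  have hPr : 1 - √(1 - y) ≤ 2 * P := by
    have := Real.abs_le_sqrt hP
    linarith [abs_le.1 this]
  have hsq : (1 - √(1 - y)) ^ 2 ≤ (2 * P) ^ 2 := by
    apply pow_le_pow_left₀ (by linarith) hPr
  -- After squaring, this is an equality when 2P = 1 - √(1 - y), and a larger P only decreases the
  -- left side.
  have hle : √(1 - (s * y + 4 * s * (1 - s) * P ^ 2)) ≤ 1 - s * (1 - √(1 - y)) := by
    apply Real.sqrt_le_iff.2
    constructor
    · nlinarith
    · nlinarith [mul_le_mul_of_nonneg_left hsq (mul_nonneg hs0.le hs1')]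
  have := mul_entCurv_le hr0 hr1 hs0 hs1 hq0 hle
  -- The terms 2y and 8s(1-s)P² add up to twice the output argument on both sides, which leaves only
  -- the `entCurv` inequality.
  unfold qubitEntRatio
  nlinarith

/-! ### Convexity in population and entropy -/

/-- The inverse of `qubitEnt` is extended to the whole line by clamping its argument, so that
compositions with it are continuous without side conditions. -/
theorem exists_qubitEnt_inverse : ∃ V : ℝ → ℝ, Continuous V ∧
    ∀ v ∈ Set.Icc 0 (Real.log 2), V v ∈ Set.Icc 0 1 ∧ qubitEnt (V v) = v := by
  have hlog : (0 : ℝ) ≤ Real.log 2 := Real.log_nonneg (by norm_num)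
  have hmaps : ∀ y ∈ Set.Icc (0 : ℝ) 1, qubitEnt y ∈ Set.Icc 0 (Real.log 2) := fun y hy =>
    ⟨qubitEnt_nonneg hy.1 hy.2, Real.binEntropy_le_log_two⟩
  let F : Set.Icc (0 : ℝ) 1 → Set.Icc 0 (Real.log 2) := fun y => ⟨qubitEnt y, hmaps y y.2⟩
  have hF : StrictMono F := fun a b hab => strictMonoOn_qubitEnt a.2 b.2 hab
  have hsurj : Function.Surjective F := by
    rintro ⟨v, hv⟩
    have := intermediate_value_Icc zero_le_one continuous_qubitEnt.continuousOn
    rw [qubitEnt_zero, qubitEnt_one] at this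
    obtain ⟨y, hy, rfl⟩ := this hv
    exact ⟨⟨y, hy⟩, rfl⟩
  let e := hF.orderIsoOfSurjective F hsurj
  refine ⟨fun v => (e.symm (Set.projIcc 0 (Real.log 2) hlog v) : ℝ),
    continuous_subtype_val.comp (e.symm.continuous.comp continuous_projIcc), ?_⟩
  intro v hv
  refine ⟨(e.symm _).2, ?_⟩
  have h1 : e (e.symm (Set.projIcc 0 (Real.log 2) hlog v)) = _ := e.apply_symm_apply _
  have h2 := congrArg Subtype.val h1
  simp only
  rw [Set.projIcc_of_mem hlog hv] at h2 ⊢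
  exact h2

/-- Pairs of a population and of an entropy of a non-pure, non-diagonal qubit state. -/
def qubitEntDomain : Set (ℝ × ℝ) :=
  {q | q.1 ∈ Set.Icc (0 : ℝ) 1 ∧ q.2 < Real.binEntropy q.1} ∩ {q | 0 < q.2}

theorem convex_qubitEntDomain : Convex ℝ qubitEntDomain :=
  (Real.strictConcave_binEntropy.concaveOn.convex_strict_hypograph).inter
    (convex_halfSpace_gt (IsLinearMap.mk (fun _ _ => rfl) (fun _ _ => rfl)) 0)

theorem qubitEnt_inverse_mem {V : ℝ → ℝ}
    (hV : ∀ v ∈ Set.Icc 0 (Real.log 2), V v ∈ Set.Icc 0 1 ∧ qubitEnt (V v) = v)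
    {P v : ℝ} (h : (P, v) ∈ qubitEntDomain) :
    v ∈ Set.Ioo 0 (Real.log 2) ∧ qubitEnt (V v) = v ∧ 0 < V v ∧ V v < 1 ∧
      (1 - 2 * P) ^ 2 ≤ 1 - V v ∧
      ∀ s, 0 < s → s ≤ 1 → s * V v + 4 * s * (1 - s) * P ^ 2 < 1 := by
  obtain ⟨⟨hP, hv⟩, hv0⟩ := h
  simp only [Set.mem_ofPred_eq] at hv hv0 hP
  have hle : Real.binEntropy P ≤ Real.log 2 := Real.binEntropy_le_log_two
  obtain ⟨hy, hVv⟩ := hV v ⟨hv0.le, (hv.trans_le hle).le⟩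
  have hP0 : 0 ≤ 4 * P * (1 - P) := mul_nonneg (by linarith [hP.1]) (by linarith [hP.2])
  have hP1 : 4 * P * (1 - P) ≤ 1 := by nlinarith [sq_nonneg (1 - 2 * P)]
  have hlt : V v < 4 * P * (1 - P) := by
    by_contra hcon
    have := monotoneOn_qubitEnt ⟨hP0, hP1⟩ hy (not_lt.1 hcon)
    rw [hVv, qubitEnt_four_mul] at this
    linarith
  have hpos : 0 < V v := by
    rcases hy.1.eq_or_lt with h0 | h0
    · rw [← h0, qubitEnt_zero] at hVv; linarith
    · exact h0
  refine ⟨⟨hv0, hv.trans_le hle⟩, hVv, hpos, hlt.trans_le hP1, by nlinarith, ?_⟩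
  intro s hs0 hs1
  -- Since V v < 4P(1-P), the left side is below 4sP(1 - sP) = 1 - (1 - 2sP)².
  nlinarith [sq_nonneg (1 - 2 * s * P), mul_lt_mul_of_pos_left hlt hs0]

theorem hasDerivAt_qubitEnt_inverse {V : ℝ → ℝ} (hVc : Continuous V)
    (hV : ∀ v ∈ Set.Icc 0 (Real.log 2), V v ∈ Set.Icc 0 1 ∧ qubitEnt (V v) = v)
    {v : ℝ} (hv : v ∈ Set.Ioo 0 (Real.log 2)) (h0 : 0 < V v) (h1 : V v < 1) :
    HasDerivAt V (qubitEntDeriv (V v))⁻¹ v := by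
  refine HasDerivAt.of_local_left_inverse hVc.continuousAt (hasDerivAt_qubitEnt h0 h1)
    (qubitEntDeriv_pos h0 h1).ne' ?_
  filter_upwards [Icc_mem_nhds hv.1 hv.2] with w hw
  exact (hV w hw).2

/-- Cauchy-Schwarz with weights sθ and 8s(1-s)P²; the defect is the square of D P - θ e. -/
theorem sq_add_div_le_of_ratio {s D P e θ θ' : ℝ} (hs0 : 0 < s) (hs1 : s ≤ 1) (hθ : 0 < θ)
    (hθ' : s * θ + 8 * s * (1 - s) * P ^ 2 ≤ θ') :
    (s * D + 8 * s * (1 - s) * P * e) ^ 2 / θ' ≤ s * (D ^ 2 / θ) + 8 * s * (1 - s) * e ^ 2 := by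
  have hs1' : 0 ≤ 1 - s := by linarith
  have hpos : 0 < s * θ + 8 * s * (1 - s) * P ^ 2 := by positivity
  rw [div_le_iff₀ (hpos.trans_le hθ')]
  refine le_trans ?_ (mul_le_mul_of_nonneg_left hθ' (by positivity))
  have key : (s * (D ^ 2 / θ) + 8 * s * (1 - s) * e ^ 2) *
      (s * θ + 8 * s * (1 - s) * P ^ 2) - (s * D + 8 * s * (1 - s) * P * e) ^ 2 =
      8 * s ^ 2 * (1 - s) * (D * P - θ * e) ^ 2 / θ := by
    field_simp
    ring
  have : 0 ≤ 8 * s ^ 2 * (1 - s) * (D * P - θ * e) ^ 2 / θ := by positivity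
  linarith

/-- Restrict to a segment and write y = V(v), z = sy + 4s(1-s)P². With θ = `qubitEntRatio`, the
inverse satisfies y'' = y'²/θ(y), and the second derivative of the entropy is `qubitEntDeriv z`
times z'' - z'²/θ(z). Nonnegativity of the latter is `sq_add_div_le_of_ratio`, fed by
`qubitEntRatio_damping`. -/
theorem convexOn_qubitEnt_damping {V : ℝ → ℝ} (hVc : Continuous V)
    (hV : ∀ v ∈ Set.Icc 0 (Real.log 2), V v ∈ Set.Icc 0 1 ∧ qubitEnt (V v) = v)
    {s : ℝ} (hs0 : 0 < s) (hs1 : s ≤ 1) :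
    ConvexOn ℝ qubitEntDomain
      (fun q => qubitEnt (s * V q.2 + 4 * s * (1 - s) * q.1 ^ 2)) := by
  refine ⟨convex_qubitEntDomain, ?_⟩
  rintro ⟨P₀, v₀⟩ h₀ ⟨P₁, v₁⟩ h₁ a b ha hb hab
  have hs1' : 0 ≤ 1 - s := by linarith
  let P : ℝ → ℝ := fun τ => P₀ + τ * (P₁ - P₀)
  let v : ℝ → ℝ := fun τ => v₀ + τ * (v₁ - v₀)
  let z : ℝ → ℝ := fun τ => s * V (v τ) + 4 * s * (1 - s) * P τ ^ 2
  let z' : ℝ → ℝ := fun τ => s * ((qubitEntDeriv (V (v τ)))⁻¹ * (v₁ - v₀)) +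
    8 * s * (1 - s) * P τ * (P₁ - P₀)
  have hmem : ∀ τ ∈ Set.Icc (0 : ℝ) 1, (P τ, v τ) ∈ qubitEntDomain := by
    intro τ hτ
    have := convex_qubitEntDomain h₀ h₁ (sub_nonneg.2 hτ.2) hτ.1 (by ring)
    convert this using 1
    simp [P, v]
    constructor <;> ring
  have hP : ∀ τ, HasDerivAt P (P₁ - P₀) τ := fun τ =>
    (((hasDerivAt_id τ).mul_const (P₁ - P₀)).const_add P₀).congr_deriv (one_mul _)
  have hv : ∀ τ, HasDerivAt v (v₁ - v₀) τ := fun τ =>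
    (((hasDerivAt_id τ).mul_const (v₁ - v₀)).const_add v₀).congr_deriv (one_mul _)
  have hPc : Continuous P := by fun_prop
  have hvc : Continuous v := by fun_prop
  have hconv : ConvexOn ℝ (Set.Icc (0 : ℝ) 1) (fun τ => qubitEnt (z τ)) := by
    refine convexOn_of_hasDerivWithinAt2_nonneg (convex_Icc 0 1)
      (f' := fun τ => qubitEntDeriv (z τ) * z' τ)
      (f'' := fun τ => -(qubitEntDeriv (z τ) / qubitEntRatio (z τ)) * z' τ * z' τ +
        qubitEntDeriv (z τ) * (s * (((qubitEntDeriv (V (v τ)))⁻¹ * (v₁ - v₀)) ^ 2 /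
          qubitEntRatio (V (v τ))) + 8 * s * (1 - s) * (P₁ - P₀) ^ 2))
      (continuous_qubitEnt.comp (by fun_prop)).continuousOn ?_ ?_ ?_
    all_goals
      intro τ hτ
      obtain ⟨hvI, hVv, hy0, hy1, hPy, hz1⟩ := qubitEnt_inverse_mem hV (hmem τ (interior_subset hτ))
      have hz1 : z τ < 1 := hz1 s hs0 hs1
      have hz0 : 0 < z τ := by simp only [z]; positivity
      have hY : HasDerivAt (fun τ => V (v τ)) ((qubitEntDeriv (V (v τ)))⁻¹ * (v₁ - v₀)) τ :=
        (hasDerivAt_qubitEnt_inverse hVc hV hvI hy0 hy1).comp τ (hv τ)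
      have hβ := qubitEntDeriv_pos hy0 hy1
      have hθ := qubitEntRatio_pos hy0 hy1
      have hz : HasDerivAt z (z' τ) τ := by
        refine ((hY.const_mul s).add (((hP τ).pow 2).const_mul (4 * s * (1 - s)))).congr_deriv ?_
        simp only [z']; ring
    · exact ((hasDerivAt_qubitEnt hz0 hz1).comp τ hz).hasDerivWithinAt
    · have hz' : HasDerivAt z' (s * (((qubitEntDeriv (V (v τ)))⁻¹ * (v₁ - v₀)) ^ 2 /
          qubitEntRatio (V (v τ))) + 8 * s * (1 - s) * (P₁ - P₀) ^ 2) τ := by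
        have h0 : HasDerivAt (fun τ => qubitEntDeriv (V (v τ)))
            (-(qubitEntDeriv (V (v τ)) / qubitEntRatio (V (v τ))) *
              ((qubitEntDeriv (V (v τ)))⁻¹ * (v₁ - v₀))) τ :=
          HasDerivAt.comp (h₂ := qubitEntDeriv) (h := fun τ => V (v τ)) τ
            (hasDerivAt_qubitEntDeriv hy0 hy1) hY
        have h1 := (h0.inv hβ.ne').mul_const (v₁ - v₀)
        have h2 := ((hP τ).const_mul (8 * s * (1 - s))).mul_const (P₁ - P₀)
        refine ((h1.const_mul s).add h2).congr_deriv ?_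
        field_simp
      have := ((hasDerivAt_qubitEntDeriv hz0 hz1).comp τ hz).mul hz'
      exact this.hasDerivWithinAt
    · have hk := qubitEntRatio_damping hy0 hy1 hs0 hs1 hPy hz1
      have hcs := sq_add_div_le_of_ratio (D := (qubitEntDeriv (V (v τ)))⁻¹ * (v₁ - v₀))
        (e := P₁ - P₀) hs0 hs1 hθ hk
      have hb := qubitEntDeriv_pos hz0 hz1
      have e : -(qubitEntDeriv (z τ) / qubitEntRatio (z τ)) * z' τ * z' τ =
        - (qubitEntDeriv (z τ) * (z' τ ^ 2 / qubitEntRatio (z τ))) := by ring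
      rw [e, neg_add_eq_sub, ← mul_sub]
      exact mul_nonneg hb.le (sub_nonneg.2 hcs)
  have := hconv.2 (Set.left_mem_Icc.2 zero_le_one) (Set.right_mem_Icc.2 zero_le_one) ha hb hab
  simp only [z, P, v, smul_eq_mul, mul_zero, mul_one, zero_add, zero_mul, add_zero, one_mul,
    add_sub_cancel, Prod.smul_mk, Prod.mk_add_mk] at this ⊢
  obtain rfl : a = 1 - b := by linarith
  convert this using 4
  · congr 1
    ring
  · ring

/-- Jensen's inequality for the output entropy of an amplitude damping channel as a function of
the population and of the entropy of the input. -/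
theorem qubitEnt_damping_le_sum {ι : Type*} [Fintype ι] {w P y : ι → ℝ} {s Y : ℝ}
    (hw0 : ∀ i, 0 ≤ w i) (hw1 : ∑ i, w i = 1) (hP : ∀ i, P i ∈ Set.Icc (0 : ℝ) 1)
    (hy0 : ∀ i, 0 ≤ y i) (hy : ∀ i, y i ≤ 4 * P i * (1 - P i))
    (hs0 : 0 ≤ s) (hs1 : s ≤ 1) (hY : Y ∈ Set.Icc (0 : ℝ) 1)
    (hYe : qubitEnt Y = ∑ i, w i * qubitEnt (y i)) :
    qubitEnt (s * Y + 4 * s * (1 - s) * (∑ i, w i * P i) ^ 2) ≤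
      ∑ i, w i * qubitEnt (s * y i + 4 * s * (1 - s) * P i ^ 2) := by
  rcases hs0.eq_or_lt with rfl | hs0
  · simp [qubitEnt_zero]
  obtain ⟨V, hVc, hV⟩ := exists_qubitEnt_inverse
  have hy1 : ∀ i, y i ∈ Set.Icc (0 : ℝ) 1 := fun i =>
    ⟨hy0 i, (hy i).trans (by nlinarith [sq_nonneg (1 - 2 * P i)])⟩
  have hVq : ∀ t ∈ Set.Icc (0 : ℝ) 1, V (qubitEnt t) = t := fun t ht => by
    obtain ⟨h1, h2⟩ := hV (qubitEnt t) ⟨qubitEnt_nonneg ht.1 ht.2, Real.binEntropy_le_log_two⟩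
    exact strictMonoOn_qubitEnt.injOn h1 ht h2
  let Ψ : ℝ × ℝ → ℝ := fun q => qubitEnt (s * V q.2 + 4 * s * (1 - s) * q.1 ^ 2)
  have hΨc : Continuous Ψ := continuous_qubitEnt.comp (by fun_prop)
  -- Convexity is known only off the boundary of pure and diagonal states. All points are moved
  -- slightly towards the point `m` of the domain, and continuity removes the shift.
  let m : ℝ × ℝ := (1 / 2, Real.log 2 / 2)
  let q : ι → ℝ × ℝ := fun i => (P i, qubitEnt (y i))
  have hlog : 0 < Real.log 2 := Real.log_pos one_lt_two
  have hmemq : ∀ ε ∈ Set.Ioo (0 : ℝ) 1, ∀ i, (1 - ε) • q i + ε • m ∈ qubitEntDomain := by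
    intro ε hε i
    have hv0 := qubitEnt_nonneg (hy1 i).1 (hy1 i).2
    have hle : qubitEnt (y i) ≤ Real.binEntropy (P i) := by
      rw [← qubitEnt_four_mul]
      refine monotoneOn_qubitEnt (hy1 i) ⟨(hy0 i).trans (hy i), ?_⟩ (hy i)
      nlinarith [sq_nonneg (1 - 2 * P i)]
    have hε1 : 0 < 1 - ε := by linarith [hε.2]
    have hhalf : (1 / 2 : ℝ) ∈ Set.Icc (0 : ℝ) 1 := by norm_num
    have hc := Real.strictConcave_binEntropy.concaveOn.2 (hP i) hhalf hε1.le hε.1.le (by ring)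
    have hmem := (convex_Icc (0 : ℝ) 1) (hP i) hhalf hε1.le hε.1.le (by ring)
    have hb2 : Real.binEntropy (1 / 2) = Real.log 2 := by
      rw [one_div]; exact Real.binEntropy_two_inv
    simp only [smul_eq_mul, hb2] at hc hmem
    refine ⟨⟨?_, ?_⟩, ?_⟩
    · simpa [q, m] using hmem
    · simp only [q, m, Prod.smul_mk, Prod.mk_add_mk, smul_eq_mul]
      have h1 := mul_le_mul_of_nonneg_left hle hε1.le
      have h2 := mul_lt_mul_of_pos_left (show Real.log 2 / 2 < Real.log 2 by linarith) hε.1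
      linarith
    · simp only [q, m, Prod.smul_mk, Prod.mk_add_mk, smul_eq_mul, Set.mem_ofPred_eq]
      have h1 := mul_nonneg hε1.le hv0
      have h2 := mul_pos hε.1 (half_pos hlog)
      linarith
  have hconv := convexOn_qubitEnt_damping hVc hV hs0 hs1
  have hineq : ∀ ε ∈ Set.Ioo (0 : ℝ) 1,
      Ψ ((1 - ε) • (∑ i, w i • q i) + ε • m) ≤ ∑ i, w i * Ψ ((1 - ε) • q i + ε • m) := by
    intro ε hε
    have h := hconv.map_sum_le (t := Finset.univ) (fun i _ => hw0 i) hw1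
      (fun i _ => hmemq ε hε i)
    have e : ∑ i, w i • ((1 - ε) • q i + ε • m) = (1 - ε) • (∑ i, w i • q i) + ε • m := by
      simp_rw [smul_add, Finset.sum_add_distrib, ← Finset.sum_smul, hw1, one_smul,
        Finset.smul_sum, smul_comm (1 - ε)]
    rw [e] at h
    exact h
  have hlim : Ψ (∑ i, w i • q i) ≤ ∑ i, w i * Ψ (q i) := by
    have h1 : Filter.Tendsto (fun ε : ℝ => Ψ ((1 - ε) • (∑ i, w i • q i) + ε • m))
        (nhdsWithin 0 (Set.Ioi 0)) (nhds (Ψ (∑ i, w i • q i))) := by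
      have hc : Continuous fun ε : ℝ => Ψ ((1 - ε) • (∑ i, w i • q i) + ε • m) := by fun_prop
      have := (hc.tendsto 0).mono_left (nhdsWithin_le_nhds (s := Set.Ioi 0))
      simpa using this
    have h2 : Filter.Tendsto (fun ε : ℝ => ∑ i, w i * Ψ ((1 - ε) • q i + ε • m))
        (nhdsWithin 0 (Set.Ioi 0)) (nhds (∑ i, w i * Ψ (q i))) := by
      have hc : Continuous fun ε : ℝ => ∑ i, w i * Ψ ((1 - ε) • q i + ε • m) := by fun_prop
      have := (hc.tendsto 0).mono_left (nhdsWithin_le_nhds (s := Set.Ioi 0))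
      simpa using this
    refine le_of_tendsto_of_tendsto h1 h2 ?_
    filter_upwards [Ioo_mem_nhdsGT (zero_lt_one' ℝ)] with ε hε
    exact hineq ε hε
  have e1 : ∑ i, w i • q i = (∑ i, w i * P i, qubitEnt Y) := by
    rw [hYe]
    ext <;> simp [q, Prod.fst_sum, Prod.snd_sum]
  rw [e1] at hlim
  simp only [Ψ, q, hVq Y hY] at hlim
  refine hlim.trans_eq (Finset.sum_congr rfl fun i _ => ?_)
  rw [hVq _ (hy1 i)]

/-! ### Von Neumann entropy from characteristic polynomials -/

-- Any real factorization of the characteristic polynomial lists the eigenvalues, over an index type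
-- unrelated to that of the matrix.
open Polynomial in
theorem vonNeumannEntropy_eq_of_charpoly {ι κ : Type} [Fintype ι] [DecidableEq ι] [Fintype κ]
    {ρ : Matrix ι ι ℂ} (hρ : ρ.IsHermitian) {d : κ → ℝ}
    (h : ρ.charpoly = ∏ i, (X - C (d i : ℂ))) :
    vonNeumannEntropy ρ = (∑ i, Real.negMulLog (d i)) / Real.log 2 := by
  -- The eigenvalues in `vonNeumannEntropy` use classical decidable equality, so the given instance
  -- is identified with it.
  obtain rfl : (fun a b : ι => Classical.propDecidable (a = b)) = ‹DecidableEq ι› :=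
    Subsingleton.elim _ _
  classical
  have h1 := hρ.roots_charpoly_eq_eigenvalues
  have h2 : ρ.charpoly.roots = Multiset.map (fun i => (d i : ℂ)) Finset.univ.val := by
    rw [h, Polynomial.roots_prod]
    · simp
    · simp [Finset.prod_ne_zero_iff, Polynomial.X_sub_C_ne_zero]
  rw [h2] at h1
  have h3 := congrArg (fun m => (Multiset.map (fun z : ℂ => Real.negMulLog z.re) m).sum) h1
  simp only [Multiset.map_map, Function.comp_def] at h3
  rw [vonNeumannEntropy, dif_pos hρ]
  have h4 : ∑ i, Real.negMulLog (d i) = ∑ i, Real.negMulLog (hρ.eigenvalues i) := by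
    simpa using h3
  rw [h4, Finset.sum_div, ← Finset.sum_neg_distrib]
  refine Finset.sum_congr rfl fun i _ => ?_
  simp only [Real.negMulLog, Real.logb]
  ring

open Polynomial in
theorem Matrix.IsHermitian.charpoly_smul {ι : Type} [Fintype ι] [DecidableEq ι]
    {σ : Matrix ι ι ℂ} (hσ : σ.IsHermitian) (p : ℝ) :
    ((p : ℂ) • σ).charpoly = ∏ i, (X - C ((p * hσ.eigenvalues i : ℝ) : ℂ)) := by
  conv_lhs => rw [hσ.spectral_theorem, ← map_smul, Unitary.conjStarAlgAut_apply,
    Matrix.charpoly_mul_comm, ← mul_assoc]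
  simp [← Matrix.diagonal_smul, Matrix.charpoly_diagonal]

open Polynomial in
theorem Matrix.charpoly_blockDiagonal {o m R : Type} [CommRing R] [Fintype o] [DecidableEq o]
    [Fintype m] [DecidableEq m] (M : o → Matrix m m R) :
    (Matrix.blockDiagonal M).charpoly = ∏ k, (M k).charpoly := by
  have h : (Matrix.blockDiagonal M).charmatrix =
      Matrix.blockDiagonal fun k => (M k).charmatrix := by
    ext1 ⟨i, k⟩ ⟨j, l⟩
    simp only [Matrix.charmatrix_apply, Matrix.blockDiagonal_apply, Matrix.diagonal_apply,
      Prod.mk.injEq]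
    by_cases hkl : k = l <;> simp [hkl]
  rw [Matrix.charpoly, h, Matrix.det_blockDiagonal]
  rfl

/-- The state `∑ₓ pₓ |x⟩⟨x| ⊗ σₓ`. -/
def cqMatrix {X β : Type} [DecidableEq X] (p : X → ℝ) (σ : X → Matrix β β ℂ) :
    Matrix (X × β) (X × β) ℂ :=
  Matrix.of fun s t => if s.1 = t.1 then (p s.1 : ℂ) * σ s.1 s.2 t.2 else 0

/-- Chain rule H(X) + H(β|X): the matrix is block diagonal with eigenvalues pₓ λ, and each block's λ
sum to 1. -/
theorem vonNeumannEntropy_cqMatrix {X β : Type} [Fintype X] [DecidableEq X] [Fintype β]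
    (p : X → ℝ) {σ : X → Matrix β β ℂ} (hσ : ∀ x, (σ x).IsHermitian)
    (htr : ∀ x, (σ x).trace = 1) :
    vonNeumannEntropy (cqMatrix p σ) =
      (∑ x, Real.negMulLog (p x)) / Real.log 2 + ∑ x, p x * vonNeumannEntropy (σ x) := by
  classical
  have hb : cqMatrix p σ = Matrix.reindex (Equiv.prodComm β X) (Equiv.prodComm β X)
      (Matrix.blockDiagonal fun x => (p x : ℂ) • σ x) := by
    ext ⟨x, b⟩ ⟨x', b'⟩
    simp [cqMatrix, Matrix.blockDiagonal_apply]
  have hc : (cqMatrix p σ).charpoly = ∏ s : X × β, (Polynomial.X -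
      Polynomial.C ((p s.1 * (hσ s.1).eigenvalues s.2 : ℝ) : ℂ)) := by
    rw [hb, Matrix.charpoly_reindex, Matrix.charpoly_blockDiagonal, Fintype.prod_prod_type]
    exact Finset.prod_congr rfl fun x _ => (hσ x).charpoly_smul (p x)
  have hh : (cqMatrix p σ).IsHermitian := by
    ext ⟨x, b⟩ ⟨x', b'⟩
    simp only [cqMatrix, Matrix.conjTranspose_apply, Matrix.of_apply]
    by_cases h : x = x'
    · subst h
      have := (hσ x).apply b b'
      simp [this]
    · simp [h, Ne.symm h]
  rw [vonNeumannEntropy_eq_of_charpoly hh hc, Fintype.sum_prod_type, Finset.sum_div,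
    Finset.sum_div, ← Finset.sum_add_distrib]
  refine Finset.sum_congr rfl fun x _ => ?_
  rw [vonNeumannEntropy_eq_of_charpoly (d := (hσ x).eigenvalues) (hσ x) (hσ x).charpoly_eq]
  have h1 : ∑ i, (hσ x).eigenvalues i = 1 := by
    have := (hσ x).trace_eq_sum_eigenvalues
    rw [htr x] at this
    apply Complex.ofReal_injective
    simpa using this.symm
  simp_rw [Real.negMulLog_mul]
  rw [Finset.sum_add_distrib, ← Finset.sum_mul, h1, ← Finset.mul_sum]
  ring

/-- The two marginals of a pure state have the same entropy: the characteristic polynomials agree up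
to powers of X, and zero eigenvalues contribute nothing. -/
theorem vonNeumannEntropy_mul_conjTranspose {m n : Type} [Fintype m] [Fintype n]
    (W : Matrix m n ℂ) : vonNeumannEntropy (W * Wᴴ) = vonNeumannEntropy (Wᴴ * W) := by
  classical
  have h1 : (W * Wᴴ).IsHermitian := Matrix.isHermitian_mul_conjTranspose_self W
  have h2 : (Wᴴ * W).IsHermitian := Matrix.isHermitian_conjTranspose_mul_self W
  have h := Matrix.charpoly_mul_comm' W Wᴴ
  have hr := congrArg (fun q => (Multiset.map (fun z : ℂ => Real.negMulLog z.re)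
    (Polynomial.roots q)).sum) h
  have hX : ∀ k : ℕ, (Polynomial.X ^ k : Polynomial ℂ) ≠ 0 := fun k =>
    pow_ne_zero _ Polynomial.X_ne_zero
  rw [Polynomial.roots_mul (mul_ne_zero (hX _) (Matrix.charpoly_monic _).ne_zero),
    Polynomial.roots_mul (mul_ne_zero (hX _) (Matrix.charpoly_monic _).ne_zero),
    h1.roots_charpoly_eq_eigenvalues, h2.roots_charpoly_eq_eigenvalues] at hr
  rw [vonNeumannEntropy_eq_of_charpoly (d := h1.eigenvalues) h1 h1.charpoly_eq,
    vonNeumannEntropy_eq_of_charpoly (d := h2.eigenvalues) h2 h2.charpoly_eq]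
  congr 1
  simpa [Multiset.map_nsmul, Multiset.sum_nsmul] using hr

theorem vonNeumannEntropy_transpose {m : Type} [Fintype m] {ρ : Matrix m m ℂ}
    (h : ρ.IsHermitian) : vonNeumannEntropy ρᵀ = vonNeumannEntropy ρ := by
  classical
  rw [vonNeumannEntropy_eq_of_charpoly (d := h.eigenvalues) h h.charpoly_eq,
    vonNeumannEntropy_eq_of_charpoly (d := h.eigenvalues) h.transpose
      ((Matrix.charpoly_transpose ρ).trans h.charpoly_eq)]

/-- Positivity of `ρ` is not needed: the eigenvalues (1 ± √(1 - D)) / 2 are real once D ≤ 1, and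
both entropies extend to negative arguments in the same way. -/
theorem vonNeumannEntropy_fin_two {ρ : Matrix (Fin 2) (Fin 2) ℂ} (h : ρ.IsHermitian)
    (htr : ρ.trace = 1) {D : ℝ} (hD : ρ.det = ((D / 4 : ℝ) : ℂ)) (hD1 : D ≤ 1) :
    vonNeumannEntropy ρ = qubitEnt D / Real.log 2 := by
  have hs : ((√(1 - D) : ℝ) : ℂ) ^ 2 = 1 - (D : ℂ) := by
    rw [← Complex.ofReal_pow, Real.sq_sqrt (by linarith)]; push_cast; ring
  have hc : ρ.charpoly = ∏ i : Fin 2, (Polynomial.X - Polynomial.C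
      ((![(1 + √(1 - D)) / 2, 1 - (1 + √(1 - D)) / 2] i : ℝ) : ℂ)) := by
    rw [Matrix.charpoly_fin_two, htr, hD, Fin.prod_univ_two]
    have e : ((D / 4 : ℝ) : ℂ) =
        (((1 + √(1 - D)) / 2 : ℝ) : ℂ) * ((1 - (1 + √(1 - D)) / 2 : ℝ) : ℂ) := by
      push_cast
      linear_combination (1 / 4 : ℂ) * hs
    have e2 : (1 : ℂ) =
        (((1 + √(1 - D)) / 2 : ℝ) : ℂ) + ((1 - (1 + √(1 - D)) / 2 : ℝ) : ℂ) := by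
      push_cast; ring
    rw [e]
    conv_lhs => rw [e2]
    simp only [Matrix.cons_val_zero, Matrix.cons_val_one, Polynomial.C_add, Polynomial.C_mul]
    ring
  rw [vonNeumannEntropy_eq_of_charpoly h hc, Fin.sum_univ_two, qubitEnt,
    Real.binEntropy_eq_negMulLog_add_negMulLog_one_sub]
  rfl

theorem vonNeumannEntropy_diagonal {X : Type} [Fintype X] [DecidableEq X] (p : X → ℝ) :
    vonNeumannEntropy (Matrix.diagonal fun x => (p x : ℂ)) =
      (∑ x, Real.negMulLog (p x)) / Real.log 2 := by
  refine vonNeumannEntropy_eq_of_charpoly ?_ (Matrix.charpoly_diagonal _)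
  exact Matrix.isHermitian_diagonal_of_self_adjoint _ (by ext; simp)

/-! ### The channel and the marginals of classical-quantum states -/

theorem h2_eq (y : ℝ) : h2 y = Real.binEntropy y / Real.log 2 := by
  simp only [h2, Real.logb, Real.binEntropy, Real.log_inv]
  ring

theorem gFun_eq (q z ν : ℝ) : gFun q z ν =
    qubitEnt (4 * (z * q) * (1 - z * q) - 4 * z * (ν ^ 2 * (q * (1 - q)))) / Real.log 2 := by
  rw [gFun, h2_eq, qubitEnt]
  congr 5
  ring

theorem amplitudeDamping_apply {η : ℝ} (h0 : 0 ≤ η) (h1 : η ≤ 1) (m : Matrix (Fin 2) (Fin 2) ℂ) :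
    amplitudeDamping η m = !![(η : ℂ) * m 0 0, (√η : ℂ) * m 0 1;
      (√η : ℂ) * m 1 0, m 1 1 + ((1 - η : ℝ) : ℂ) * m 0 0] := by
  have e0 : ((√η : ℝ) : ℂ) * ((√η : ℝ) : ℂ) = (η : ℂ) := by
    rw [← Complex.ofReal_mul, Real.mul_self_sqrt h0]
  have e1 : ((√(1 - η) : ℝ) : ℂ) * ((√(1 - η) : ℝ) : ℂ) = ((1 - η : ℝ) : ℂ) := by
    rw [← Complex.ofReal_mul, Real.mul_self_sqrt (by linarith)]
  ext i j
  fin_cases i <;> fin_cases j <;>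
    simp [amplitudeDamping, krausMap, amplitudeDampingKraus, Matrix.mul_apply, Fin.sum_univ_two,
      Matrix.single_apply, Matrix.add_apply, ← e0]
  · ring
  · ring
  · push_cast at e1
    linear_combination (m 0 0) * e1 + (m 0 0) * e0

theorem trace_amplitudeDamping {η : ℝ} (h0 : 0 ≤ η) (h1 : η ≤ 1)
    (m : Matrix (Fin 2) (Fin 2) ℂ) : (amplitudeDamping η m).trace = m.trace := by
  rw [amplitudeDamping_apply h0 h1, Matrix.trace_fin_two, Matrix.trace_fin_two]
  simp
  ring

theorem margAX_cqMatrix {X A B : Type} [DecidableEq X] [Fintype B]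
    (p : X → ℝ) (σ : X → Matrix (A × B) (A × B) ℂ) :
    margAX (cqMatrix p σ) =
      cqMatrix p fun x => Matrix.of fun a a' => ∑ b, σ x (a, b) (a', b) := by
  ext ⟨x, a⟩ ⟨x', a'⟩
  by_cases h : x = x' <;> simp [margAX, cqMatrix, h, Finset.mul_sum]

theorem margBX_cqMatrix {X A B : Type} [DecidableEq X] [Fintype A] [Fintype B]
    (p : X → ℝ) (σ : X → Matrix (A × B) (A × B) ℂ) :
    margBX (cqMatrix p σ) =
      cqMatrix p fun x => Matrix.of fun b b' => ∑ a, σ x (a, b) (a, b') := by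
  ext ⟨x, a⟩ ⟨x', a'⟩
  by_cases h : x = x' <;> simp [margBX, cqMatrix, h, Finset.mul_sum]

theorem margB_cqMatrix {X A B : Type} [Fintype X] [DecidableEq X] [Fintype A] [Fintype B]
    (p : X → ℝ) (σ : X → Matrix (A × B) (A × B) ℂ) :
    margB (cqMatrix p σ) =
      ∑ x, (p x : ℂ) • Matrix.of fun b b' => ∑ a, σ x (a, b) (a, b') := by
  ext b b'
  simp [margB, cqMatrix, Finset.mul_sum, Matrix.sum_apply]

theorem margX_cqMatrix {X A B : Type} [DecidableEq X] [Fintype A] [Fintype B]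
    (p : X → ℝ) {σ : X → Matrix (A × B) (A × B) ℂ}
    (hσ : ∀ x, (σ x).trace = 1) :
    margX (cqMatrix p σ) = Matrix.diagonal fun x => (p x : ℂ) := by
  ext x x'
  by_cases h : x = x'
  · subst h
    have := hσ x
    simp only [Matrix.trace, Matrix.diag_apply, Fintype.sum_prod_type] at this
    simp [margX, cqMatrix, ← Finset.mul_sum, this]
  · simp [margX, cqMatrix, h]

/-! ### Informations of an ensemble in terms of determinants -/

namespace PureEnsemble

variable {X A : Type} [Fintype X] [Fintype A] (e : PureEnsemble X A (Fin 2))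

theorem proj_apply (x : X) (s t : A × Fin 2) :
    e.proj x s t = e.vec x s * conj (e.vec x t) := rfl

theorem inputState_apply (x : X) (i j : Fin 2) :
    e.inputState x i j = ∑ a, e.vec x (a, i) * conj (e.vec x (a, j)) := rfl

theorem inputState_isHermitian (x : X) : (e.inputState x).IsHermitian := by
  ext i j
  simp [Matrix.conjTranspose_apply, inputState_apply, mul_comm]

/-- The population `⟨0|ρˣ|0⟩` of the input state. -/
noncomputable def population (x : X) : ℝ := (e.inputState x 0 0).re

/-- The squared modulus of the coherence `⟨0|ρˣ|1⟩` of the input state. -/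
noncomputable def sqCoherence (x : X) : ℝ := Complex.normSq (e.inputState x 0 1)

theorem inputState_diag (x : X) (i : Fin 2) :
    e.inputState x i i = ((∑ a, ‖e.vec x (a, i)‖ ^ 2 : ℝ) : ℂ) := by
  rw [inputState_apply]
  push_cast
  exact Finset.sum_congr rfl fun a _ => Complex.mul_conj' _

theorem population_eq (x : X) : e.population x = ∑ a, ‖e.vec x (a, 0)‖ ^ 2 := by
  rw [population, inputState_diag, Complex.ofReal_re]

theorem one_sub_population_eq (x : X) : 1 - e.population x = ∑ a, ‖e.vec x (a, 1)‖ ^ 2 := by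
  have := e.vec_norm x
  rw [Fintype.sum_prod_type] at this
  simp_rw [Fin.sum_univ_two] at this
  rw [Finset.sum_add_distrib] at this
  rw [population_eq]; linarith

theorem inputState_zero_zero (x : X) : e.inputState x 0 0 = (e.population x : ℂ) := by
  rw [inputState_diag, population_eq]

theorem inputState_one_one (x : X) : e.inputState x 1 1 = ((1 - e.population x : ℝ) : ℂ) := by
  rw [inputState_diag, one_sub_population_eq]

theorem inputState_one_zero (x : X) : e.inputState x 1 0 = conj (e.inputState x 0 1) :=
  ((e.inputState_isHermitian x).apply 1 0).symm

theorem inputState_mul_conj (x : X) :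
    e.inputState x 0 1 * e.inputState x 1 0 = (e.sqCoherence x : ℂ) := by
  rw [inputState_one_zero, Complex.mul_conj, sqCoherence]

theorem inputState_trace (x : X) : (e.inputState x).trace = 1 := by
  rw [Matrix.trace_fin_two, inputState_zero_zero, inputState_one_one]
  push_cast; ring

theorem population_mem (x : X) : e.population x ∈ Set.Icc (0 : ℝ) 1 := by
  constructor
  · rw [population_eq]; positivity
  · have : 0 ≤ 1 - e.population x := by rw [one_sub_population_eq]; positivity
    linarith

theorem sqCoherence_nonneg (x : X) : 0 ≤ e.sqCoherence x := Complex.normSq_nonneg _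

theorem sqCoherence_le (x : X) : e.sqCoherence x ≤ e.population x * (1 - e.population x) := by
  rw [one_sub_population_eq, population_eq, sqCoherence, Complex.normSq_eq_norm_sq,
    inputState_apply]
  have h1 : ‖∑ a, e.vec x (a, 0) * conj (e.vec x (a, 1))‖ ≤
      ∑ a, ‖e.vec x (a, 0)‖ * ‖e.vec x (a, 1)‖ := by
    refine (norm_sum_le _ _).trans_eq (Finset.sum_congr rfl fun a _ => ?_)
    rw [norm_mul, RCLike.norm_conj]
  refine (pow_le_pow_left₀ (norm_nonneg _) h1 2).trans ?_
  exact Finset.sum_mul_sq_le_sq_mul_sq _ _ _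

/-- Four times the determinant of the output of the amplitude damping channel with
transmissivity `z`. -/
noncomputable def levelDet (z : ℝ) (x : X) : ℝ :=
  4 * (z * e.population x) * (1 - z * e.population x) - 4 * z * e.sqCoherence x

theorem levelDet_le {z : ℝ} (hz : 0 ≤ z) (x : X) :
    e.levelDet z x ≤ 4 * (z * e.population x) * (1 - z * e.population x) := by
  have := mul_nonneg hz (e.sqCoherence_nonneg x)
  unfold levelDet; linarith

theorem levelDet_le_one {z : ℝ} (hz : 0 ≤ z) (x : X) : e.levelDet z x ≤ 1 := by
  refine (e.levelDet_le hz x).trans ?_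
  nlinarith [sq_nonneg (1 - 2 * (z * e.population x))]

theorem levelDet_nonneg {z : ℝ} (hz : 0 ≤ z) (hz1 : z ≤ 1) (x : X) : 0 ≤ e.levelDet z x := by
  have h1 := mul_le_mul_of_nonneg_left (e.sqCoherence_le x) hz
  have h2 : 0 ≤ z * (1 - z) * e.population x ^ 2 :=
    mul_nonneg (mul_nonneg hz (by linarith)) (sq_nonneg _)
  unfold levelDet
  nlinarith

/-- The composition law A_{sz} = A_s ∘ A_z at the level of determinants; z times the population is
the population after A_z. -/
theorem levelDet_mul (s z : ℝ) (x : X) :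
    e.levelDet (s * z) x = s * e.levelDet z x + 4 * s * (1 - s) * (z * e.population x) ^ 2 := by
  unfold levelDet; ring

/-- The amplitudes of the input vectors as a matrix. -/
noncomputable def vecMatrix (x : X) : Matrix A (Fin 2) ℂ := Matrix.of fun a i => e.vec x (a, i)

/-- The amplitudes of the isometric extension of the channel applied to the input vectors, as a
matrix from the environment to the reference and the output. -/
noncomputable def outMatrix (η : ℝ) (x : X) : Matrix (A × Fin 2) (Fin 2) ℂ :=
  Matrix.of fun s k => ∑ i, amplitudeDampingKraus η k s.2 i * e.vec x (s.1, i)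

theorem idTensor_proj (η : ℝ) (x : X) :
    idTensor (amplitudeDamping η) (e.proj x) = e.outMatrix η x * (e.outMatrix η x)ᴴ := by
  ext ⟨a, b⟩ ⟨a', b'⟩
  simp only [idTensor, amplitudeDamping, krausMap, outMatrix, Matrix.of_apply, LinearMap.coe_mk,
    AddHom.coe_mk, Matrix.add_apply, Matrix.mul_apply, Matrix.conjTranspose_apply, proj_apply,
    Fin.sum_univ_two, star_add, star_mul', RCLike.star_def]
  ring

/-- The environment state: up to exchanging the basis vectors and transposing, it is the output of
the channel with transmissivity 1 - η. -/
theorem outMatrix_gram {η : ℝ} (h0 : 0 ≤ η) (h1 : η ≤ 1) (x : X) :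
    (e.outMatrix η x)ᴴ * e.outMatrix η x =
      !![(η : ℂ) * e.inputState x 0 0 + e.inputState x 1 1, (√(1 - η) : ℂ) * e.inputState x 0 1;
        (√(1 - η) : ℂ) * e.inputState x 1 0, ((1 - η : ℝ) : ℂ) * e.inputState x 0 0] := by
  have e0 : ((√η : ℝ) : ℂ) * ((√η : ℝ) : ℂ) = (η : ℂ) := by
    rw [← Complex.ofReal_mul, Real.mul_self_sqrt h0]
  have e1 : ((√(1 - η) : ℝ) : ℂ) * ((√(1 - η) : ℝ) : ℂ) = ((1 - η : ℝ) : ℂ) := by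
    rw [← Complex.ofReal_mul, Real.mul_self_sqrt (by linarith)]
  rw [← e0, ← e1]
  ext i j
  fin_cases i <;> fin_cases j <;>
    simp [Matrix.mul_apply, outMatrix, amplitudeDampingKraus, Fin.sum_univ_two,
      Matrix.single_apply, Fintype.sum_prod_type, inputState_apply, Finset.mul_sum,
      Finset.sum_add_distrib]
  all_goals try rw [← Finset.sum_add_distrib]
  all_goals try rw [← Finset.sum_add_distrib]
  all_goals exact Finset.sum_congr rfl fun a _ => by ring

theorem entropy_idTensor {η : ℝ} (h0 : 0 ≤ η) (h1 : η ≤ 1) (x : X) :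
    vonNeumannEntropy (idTensor (amplitudeDamping η) (e.proj x)) =
      qubitEnt (e.levelDet (1 - η) x) / Real.log 2 := by
  rw [idTensor_proj, vonNeumannEntropy_mul_conjTranspose]
  have e1 : ((√(1 - η) : ℝ) : ℂ) * ((√(1 - η) : ℝ) : ℂ) = ((1 - η : ℝ) : ℂ) := by
    rw [← Complex.ofReal_mul, Real.mul_self_sqrt (by linarith)]
  refine vonNeumannEntropy_fin_two (Matrix.isHermitian_conjTranspose_mul_self _) ?_ ?_
    (e.levelDet_le_one (by linarith) x)
  · rw [outMatrix_gram e h0 h1, Matrix.trace_fin_two]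
    simp [inputState_zero_zero, inputState_one_one]; ring
  · rw [outMatrix_gram e h0 h1, Matrix.det_fin_two]
    have hc := e.inputState_mul_conj x
    simp only [Matrix.of_apply, Matrix.cons_val', Matrix.cons_val_zero, Matrix.cons_val_one,
      Matrix.cons_val_fin_one, inputState_zero_zero, inputState_one_one, levelDet]
    push_cast at e1 hc ⊢
    linear_combination (-(e.inputState x 0 1 * e.inputState x 1 0)) * e1 - (1 - (η : ℂ)) * hc

theorem trace_idTensor {η : ℝ} (h0 : 0 ≤ η) (h1 : η ≤ 1) (x : X) :
    (idTensor (amplitudeDamping η) (e.proj x)).trace = 1 := by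
  rw [idTensor_proj, Matrix.trace_mul_comm, outMatrix_gram e h0 h1, Matrix.trace_fin_two]
  simp [inputState_zero_zero, inputState_one_one]; ring

theorem entropy_reference (x : X) :
    vonNeumannEntropy (e.vecMatrix x * (e.vecMatrix x)ᴴ) =
      qubitEnt (e.levelDet 1 x) / Real.log 2 := by
  have h : (e.vecMatrix x)ᴴ * e.vecMatrix x = (e.inputState x)ᵀ := by
    ext i j
    simp [Matrix.mul_apply, vecMatrix, inputState_apply, mul_comm]
  rw [vonNeumannEntropy_mul_conjTranspose, h,
    vonNeumannEntropy_transpose (e.inputState_isHermitian x)]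
  refine vonNeumannEntropy_fin_two (e.inputState_isHermitian x) (e.inputState_trace x) ?_
    (e.levelDet_le_one zero_le_one x)
  rw [Matrix.det_fin_two, inputState_mul_conj, inputState_zero_zero, inputState_one_one, levelDet]
  push_cast; ring

theorem trace_reference (x : X) : (e.vecMatrix x * (e.vecMatrix x)ᴴ).trace = 1 := by
  rw [← e.inputState_trace x, Matrix.trace_mul_comm]
  simp [Matrix.trace, Matrix.mul_apply, vecMatrix, inputState_apply, mul_comm]

theorem amplitudeDamping_isHermitian {η : ℝ} (h0 : 0 ≤ η) (h1 : η ≤ 1)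
    {m : Matrix (Fin 2) (Fin 2) ℂ} (hm : m.IsHermitian) : (amplitudeDamping η m).IsHermitian := by
  have h01 := hm.apply 0 1
  have h10 := hm.apply 1 0
  have h00 := hm.apply 0 0
  have h11 := hm.apply 1 1
  rw [RCLike.star_def] at h00 h01 h10 h11
  rw [amplitudeDamping_apply h0 h1]
  ext i j
  fin_cases i <;> fin_cases j <;>
    simp [Matrix.conjTranspose_apply, h00, h01, h10, h11]

theorem entropy_output {η : ℝ} (h0 : 0 ≤ η) (h1 : η ≤ 1) (x : X) :
    vonNeumannEntropy (amplitudeDamping η (e.inputState x)) =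
      qubitEnt (e.levelDet η x) / Real.log 2 := by
  refine vonNeumannEntropy_fin_two
    (amplitudeDamping_isHermitian h0 h1 (e.inputState_isHermitian x)) ?_ ?_
    (e.levelDet_le_one h0 x)
  · rw [trace_amplitudeDamping h0 h1, inputState_trace]
  · have e0 : ((√η : ℝ) : ℂ) * ((√η : ℝ) : ℂ) = (η : ℂ) := by
      rw [← Complex.ofReal_mul, Real.mul_self_sqrt h0]
    rw [amplitudeDamping_apply h0 h1, Matrix.det_fin_two]
    have hc := e.inputState_mul_conj x
    simp only [Matrix.of_apply, Matrix.cons_val', Matrix.cons_val_zero, Matrix.cons_val_one,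
      Matrix.cons_val_fin_one, inputState_zero_zero, inputState_one_one, levelDet]
    push_cast
    linear_combination (-(e.inputState x 0 1 * e.inputState x 1 0)) * e0 - (η : ℂ) * hc

theorem cqState_eq [DecidableEq X] {β : Type} (N : Matrix (Fin 2) (Fin 2) ℂ →ₗ[ℂ] Matrix β β ℂ) :
    e.cqState N = cqMatrix e.prob fun x => idTensor N (e.proj x) := by
  ext ⟨x, s⟩ ⟨x', t⟩
  simp only [cqState, cqMatrix, Matrix.sum_apply, Matrix.smul_apply, Matrix.kroneckerMap_apply,
    Matrix.of_apply, smul_eq_mul, Matrix.single_apply]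
  by_cases h : x = x'
  · subst h
    rw [Finset.sum_eq_single x]
    · simp
    · intro y _ hy
      simp [hy]
    · simp
  · rw [Finset.sum_eq_zero, if_neg h]
    intro y _
    rw [if_neg]
    · simp
    · rintro ⟨rfl, rfl⟩; exact h rfl

theorem sum_output_idTensor {η : ℝ} (h0 : 0 ≤ η) (h1 : η ≤ 1) (x : X) :
    (Matrix.of fun a a' => ∑ b, idTensor (amplitudeDamping η) (e.proj x) (a, b) (a', b)) =
      e.vecMatrix x * (e.vecMatrix x)ᴴ := by
  ext a a'
  have := trace_amplitudeDamping h0 h1 (Matrix.of fun i j => e.proj x (a, i) (a', j))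
  simp only [Matrix.trace, Matrix.diag_apply, Matrix.of_apply] at this
  simp only [idTensor, Matrix.of_apply, this]
  simp [Matrix.mul_apply, vecMatrix, proj_apply]

theorem sum_reference_idTensor {β : Type} (N : Matrix (Fin 2) (Fin 2) ℂ →ₗ[ℂ] Matrix β β ℂ)
    (x : X) :
    (Matrix.of fun b b' => ∑ a, idTensor N (e.proj x) (a, b) (a, b')) = N (e.inputState x) := by
  have h : e.inputState x = ∑ a, Matrix.of fun i j => e.proj x (a, i) (a, j) := by
    ext i j
    simp [inputState, Matrix.sum_apply]
  rw [h, map_sum]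
  ext b b'
  simp [idTensor, Matrix.sum_apply]

/-- The average population of the input. -/
noncomputable def meanPopulation : ℝ := ∑ x, e.prob x * e.population x

/-- The average coherence of the input. -/
noncomputable def meanCoherence : ℂ := ∑ x, (e.prob x : ℂ) * e.inputState x 0 1

/-- Four times the determinant of the average output. -/
noncomputable def meanDet (η : ℝ) : ℝ :=
  4 * (η * e.meanPopulation) * (1 - η * e.meanPopulation) -
    4 * η * Complex.normSq e.meanCoherence

theorem sum_inputState : ∑ x, (e.prob x : ℂ) • e.inputState x =
    !![(e.meanPopulation : ℂ), e.meanCoherence;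
      conj e.meanCoherence, ((1 - e.meanPopulation : ℝ) : ℂ)] := by
  have hp : ∑ x, (e.prob x : ℂ) = 1 := by rw [← Complex.ofReal_sum, e.prob_sum]; simp
  ext i j
  fin_cases i <;> fin_cases j <;>
    simp [Matrix.sum_apply, inputState_zero_zero, inputState_one_one, inputState_one_zero,
      meanPopulation, meanCoherence, mul_sub, Finset.sum_sub_distrib, hp]

theorem entropy_mean_output {η : ℝ} (h0 : 0 ≤ η) (h1 : η ≤ 1) :
    vonNeumannEntropy (margB (e.cqState (amplitudeDamping η))) =
      qubitEnt (e.meanDet η) / Real.log 2 := by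
  have e0 : ((√η : ℝ) : ℂ) * ((√η : ℝ) : ℂ) = (η : ℂ) := by
    rw [← Complex.ofReal_mul, Real.mul_self_sqrt h0]
  have hm : margB (e.cqState (amplitudeDamping η)) =
      amplitudeDamping η (∑ x, (e.prob x : ℂ) • e.inputState x) := by
    classical
    rw [cqState_eq, margB_cqMatrix, map_sum]
    simp_rw [map_smul, sum_reference_idTensor]
  have hh : (∑ x, (e.prob x : ℂ) • e.inputState x).IsHermitian := by
    rw [sum_inputState]
    ext i j
    fin_cases i <;> fin_cases j <;> simp [Matrix.conjTranspose_apply]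
  rw [hm]
  refine vonNeumannEntropy_fin_two (amplitudeDamping_isHermitian h0 h1 hh) ?_ ?_ ?_
  · rw [trace_amplitudeDamping h0 h1, sum_inputState, Matrix.trace_fin_two]
    simp
  · rw [amplitudeDamping_apply h0 h1, sum_inputState, Matrix.det_fin_two]
    have hc := Complex.mul_conj e.meanCoherence
    simp only [Matrix.of_apply, Matrix.cons_val', Matrix.cons_val_zero, Matrix.cons_val_one,
      Matrix.cons_val_fin_one, meanDet]
    push_cast
    linear_combination (-(e.meanCoherence * conj e.meanCoherence)) * e0 - (η : ℂ) * hc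
  · have := mul_nonneg h0 (Complex.normSq_nonneg e.meanCoherence)
    unfold meanDet
    nlinarith [sq_nonneg (1 - 2 * (η * e.meanPopulation))]

theorem entropies_cqState {η : ℝ} (h0 : 0 ≤ η) (h1 : η ≤ 1) :
    (vonNeumannEntropy (margX (e.cqState (amplitudeDamping η))) =
      (∑ x, Real.negMulLog (e.prob x)) / Real.log 2) ∧
    (vonNeumannEntropy (margAX (e.cqState (amplitudeDamping η))) =
      (∑ x, Real.negMulLog (e.prob x)) / Real.log 2 +
        (∑ x, e.prob x * qubitEnt (e.levelDet 1 x)) / Real.log 2) ∧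
    (vonNeumannEntropy (margBX (e.cqState (amplitudeDamping η))) =
      (∑ x, Real.negMulLog (e.prob x)) / Real.log 2 +
        (∑ x, e.prob x * qubitEnt (e.levelDet η x)) / Real.log 2) ∧
    (vonNeumannEntropy (e.cqState (amplitudeDamping η)) =
      (∑ x, Real.negMulLog (e.prob x)) / Real.log 2 +
        (∑ x, e.prob x * qubitEnt (e.levelDet (1 - η) x)) / Real.log 2) := by
  classical
  have htr := e.trace_idTensor h0 h1
  rw [cqState_eq, margX_cqMatrix _ htr, margAX_cqMatrix, margBX_cqMatrix]
  simp_rw [sum_output_idTensor e h0 h1, sum_reference_idTensor]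
  rw [vonNeumannEntropy_diagonal,
    vonNeumannEntropy_cqMatrix _ (fun x => Matrix.isHermitian_mul_conjTranspose_self _)
      e.trace_reference,
    vonNeumannEntropy_cqMatrix _
      (fun x => amplitudeDamping_isHermitian h0 h1 (e.inputState_isHermitian x))
      (fun x => by rw [trace_amplitudeDamping h0 h1, inputState_trace]),
    vonNeumannEntropy_cqMatrix _
      (fun x => by rw [idTensor_proj]; exact Matrix.isHermitian_mul_conjTranspose_self _) htr]
  simp_rw [entropy_reference, entropy_output e h0 h1, entropy_idTensor e h0 h1,
    Finset.sum_div, mul_div_assoc]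
  exact ⟨trivial, trivial, trivial, trivial⟩

theorem informations_cqState {η : ℝ} (h0 : 0 ≤ η) (h1 : η ≤ 1) :
    mutualInfoAXB (e.cqState (amplitudeDamping η)) =
      (qubitEnt (e.meanDet η) + ∑ x, e.prob x * qubitEnt (e.levelDet 1 x) -
        ∑ x, e.prob x * qubitEnt (e.levelDet (1 - η) x)) / Real.log 2 ∧
    coherentInfo (e.cqState (amplitudeDamping η)) =
      (∑ x, e.prob x * qubitEnt (e.levelDet η x) -
        ∑ x, e.prob x * qubitEnt (e.levelDet (1 - η) x)) / Real.log 2 ∧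
    holevoInfo (e.cqState (amplitudeDamping η)) + coherentInfo (e.cqState (amplitudeDamping η)) =
      (qubitEnt (e.meanDet η) -
        ∑ x, e.prob x * qubitEnt (e.levelDet (1 - η) x)) / Real.log 2 := by
  classical
  obtain ⟨hX, hAX, hBX, h⟩ := e.entropies_cqState h0 h1
  have hB := e.entropy_mean_output h0 h1
  rw [mutualInfoAXB, coherentInfo, holevoInfo, hX, hAX, hBX, h, hB]
  refine ⟨?_, ?_, ?_⟩ <;> ring

end PureEnsemble

/-! ### Comparison with symmetric ensembles -/

/-- Four times the determinant of the output of the amplitude damping channel with transmissivity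
`z` on the input with population `p` and coherence `ν √(p(1-p))`. -/
noncomputable def symmetricDet (p ν z : ℝ) : ℝ :=
  4 * (z * p) * (1 - z * p) - 4 * z * (ν ^ 2 * (p * (1 - p)))

theorem gFun_eq_qubitEnt (p z ν : ℝ) :
    gFun p z ν = qubitEnt (symmetricDet p ν z) / Real.log 2 := gFun_eq p z ν

theorem symmetricDet_mem {p ν z : ℝ} (hp : p ∈ Set.Icc (0 : ℝ) 1) (hν : ν ∈ Set.Icc (0 : ℝ) 1)
    (hz : z ∈ Set.Icc (0 : ℝ) 1) : symmetricDet p ν z ∈ Set.Icc (0 : ℝ) 1 := by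
  have hpp : 0 ≤ z * (p * (1 - p)) := mul_nonneg hz.1 (mul_nonneg hp.1 (by linarith [hp.2]))
  have hν2 : ν ^ 2 ≤ 1 := pow_le_one₀ hν.1 hν.2
  unfold symmetricDet
  constructor
  · have h1 : 0 ≤ z * (1 - z) * p ^ 2 :=
      mul_nonneg (mul_nonneg hz.1 (by linarith [hz.2])) (sq_nonneg p)
    nlinarith [mul_nonneg hpp (sub_nonneg.2 hν2)]
  · nlinarith [mul_nonneg hpp (sq_nonneg ν), sq_nonneg (1 - 2 * (z * p))]

theorem symmetricDet_mul (p ν s z : ℝ) : symmetricDet p ν (s * z) =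
    s * symmetricDet p ν z + 4 * s * (1 - s) * (z * p) ^ 2 := by
  unfold symmetricDet; ring

namespace PureEnsemble

variable {X A : Type} [Fintype X] [Fintype A] (e : PureEnsemble X A (Fin 2))

theorem meanPopulation_mem : e.meanPopulation ∈ Set.Icc (0 : ℝ) 1 :=
  (convex_Icc (0 : ℝ) 1).sum_mem (fun x _ => e.prob_nonneg x) e.prob_sum
    fun x _ => e.population_mem x

/-- The average entropy, in nats, of the outputs of the amplitude damping channel with
transmissivity `z`. -/
noncomputable def meanEnt (z : ℝ) : ℝ := ∑ x, e.prob x * qubitEnt (e.levelDet z x)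

theorem meanEnt_nonneg {z : ℝ} (hz : z ∈ Set.Icc (0 : ℝ) 1) : 0 ≤ e.meanEnt z :=
  Finset.sum_nonneg fun x _ => mul_nonneg (e.prob_nonneg x)
    (qubitEnt_nonneg (e.levelDet_nonneg hz.1 hz.2 x) (e.levelDet_le_one hz.1 x))

theorem four_mul_mem {q : ℝ} (hq : q ∈ Set.Icc (0 : ℝ) 1) :
    4 * q * (1 - q) ∈ Set.Icc (0 : ℝ) 1 :=
  ⟨mul_nonneg (by linarith [hq.1]) (by linarith [hq.2]), by nlinarith [sq_nonneg (1 - 2 * q)]⟩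

/-- Deleting coherences raises determinants, and binary entropy is concave in the population. -/
theorem meanEnt_le {z : ℝ} (hz : z ∈ Set.Icc (0 : ℝ) 1) :
    e.meanEnt z ≤ qubitEnt (symmetricDet e.meanPopulation 0 z) := by
  have hmem : ∀ x, z * e.population x ∈ Set.Icc (0 : ℝ) 1 := fun x =>
    ⟨mul_nonneg hz.1 (e.population_mem x).1,
      mul_le_one₀ hz.2 (e.population_mem x).1 (e.population_mem x).2⟩
  have h1 : e.meanEnt z ≤ ∑ x, e.prob x * Real.binEntropy (z * e.population x) := by
    refine Finset.sum_le_sum fun x _ => mul_le_mul_of_nonneg_left ?_ (e.prob_nonneg x)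
    rw [← qubitEnt_four_mul]
    exact monotoneOn_qubitEnt ⟨e.levelDet_nonneg hz.1 hz.2 x, e.levelDet_le_one hz.1 x⟩
      (four_mul_mem (hmem x)) (e.levelDet_le hz.1 x)
  have h2 := Real.strictConcave_binEntropy.concaveOn.le_map_sum (t := Finset.univ)
    (fun x _ => e.prob_nonneg x) e.prob_sum (fun x _ => hmem x)
  have h3 : ∑ x, e.prob x • (z * e.population x) = z * e.meanPopulation := by
    rw [meanPopulation, Finset.mul_sum]
    exact Finset.sum_congr rfl fun x _ => by rw [smul_eq_mul]; ring
  rw [h3, ← qubitEnt_four_mul] at h2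
  refine h1.trans (h2.trans_eq ?_)
  simp [symmetricDet]

/-- Y is the determinant parameter of a single state carrying the average entropy at level z; the
last bound is Jensen's inequality under A_s. -/
theorem exists_det_of_meanEnt {s z : ℝ} (hs : s ∈ Set.Icc (0 : ℝ) 1)
    (hz : z ∈ Set.Icc (0 : ℝ) 1) :
    ∃ Y, 0 ≤ Y ∧ Y ≤ symmetricDet e.meanPopulation 0 z ∧ qubitEnt Y = e.meanEnt z ∧
      qubitEnt (s * Y + 4 * s * (1 - s) * (z * e.meanPopulation) ^ 2) ≤ e.meanEnt (s * z) := by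
  have hB := symmetricDet_mem e.meanPopulation_mem (Set.left_mem_Icc.2 zero_le_one) hz
  have hivt := intermediate_value_Icc hB.1 continuous_qubitEnt.continuousOn
  rw [qubitEnt_zero] at hivt
  obtain ⟨Y, hY, hYe⟩ := hivt ⟨e.meanEnt_nonneg hz, e.meanEnt_le hz⟩
  refine ⟨Y, hY.1, hY.2, hYe, ?_⟩
  have h := qubitEnt_damping_le_sum (w := e.prob) (P := fun x => z * e.population x)
    (y := e.levelDet z) (s := s) (Y := Y) e.prob_nonneg e.prob_sum
    (fun x => ⟨mul_nonneg hz.1 (e.population_mem x).1,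
      mul_le_one₀ hz.2 (e.population_mem x).1 (e.population_mem x).2⟩)
    (e.levelDet_nonneg hz.1 hz.2) (e.levelDet_le hz.1) hs.1 hs.2 ⟨hY.1, hY.2.trans hB.2⟩ hYe
  have h3 : ∑ x, e.prob x * (z * e.population x) = z * e.meanPopulation := by
    rw [meanPopulation, Finset.mul_sum]
    exact Finset.sum_congr rfl fun x _ => by ring
  rw [h3] at h
  refine h.trans_eq (Finset.sum_congr rfl fun x _ => ?_)
  rw [levelDet_mul]

/-- A symmetric ensemble with the same average population and environment entropy has output
entropies at least as large. -/
theorem exists_coherence {t : ℝ} (ht : t ∈ Set.Icc (0 : ℝ) 1) :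
    ∃ ν ∈ Set.Icc (0 : ℝ) 1, e.meanEnt t = qubitEnt (symmetricDet e.meanPopulation ν t) ∧
      ∀ z, t ≤ z → z ≤ 1 → 0 < z →
        e.meanEnt z ≤ qubitEnt (symmetricDet e.meanPopulation ν z) := by
  have hp := e.meanPopulation_mem
  have h0 : (0 : ℝ) ∈ Set.Icc (0 : ℝ) 1 := Set.left_mem_Icc.2 zero_le_one
  have h1 : (1 : ℝ) ∈ Set.Icc (0 : ℝ) 1 := Set.right_mem_Icc.2 zero_le_one
  rcases ht.1.eq_or_lt with rfl | htpos
  · refine ⟨0, h0, ?_, fun z hz0 hz1 _ => e.meanEnt_le ⟨hz0, hz1⟩⟩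
    simp [meanEnt, levelDet, symmetricDet, qubitEnt_zero]
  obtain ⟨Y, hY0, hY1, -, hY⟩ := e.exists_det_of_meanEnt ht h1
  -- The endpoint ν = 1 is the pure input, with determinant 0 at level 1; any Y ≥ 0 there gives at
  -- least its entropy at level t. With `meanEnt_le` for ν = 0, the intermediate value theorem
  -- yields ν.
  have hlow : qubitEnt (symmetricDet e.meanPopulation 1 t) ≤ e.meanEnt t := by
    rw [mul_one] at hY
    refine le_trans ?_ hY
    have hm := symmetricDet_mem hp h1 ht
    have heq : symmetricDet e.meanPopulation 1 t =
        4 * t * (1 - t) * (1 * e.meanPopulation) ^ 2 := by unfold symmetricDet; ring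
    have hle : symmetricDet e.meanPopulation 1 t ≤
        t * Y + 4 * t * (1 - t) * (1 * e.meanPopulation) ^ 2 := by
      rw [heq]; linarith [mul_nonneg ht.1 hY0]
    have hm0 := symmetricDet_mem hp h0 ht
    have hmul := symmetricDet_mul e.meanPopulation 0 t 1
    rw [mul_one] at hmul
    exact monotoneOn_qubitEnt hm ⟨hm.1.trans hle,
      by linarith [mul_le_mul_of_nonneg_left hY1 ht.1, hm0.2]⟩ hle
  have hcont : Continuous fun ν => qubitEnt (symmetricDet e.meanPopulation ν t) :=
    continuous_qubitEnt.comp (by unfold symmetricDet; fun_prop)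
  obtain ⟨ν, hν, hνe⟩ := intermediate_value_Icc' zero_le_one hcont.continuousOn
    ⟨hlow, e.meanEnt_le ht⟩
  refine ⟨ν, hν, hνe.symm, fun z htz hz1 hz => ?_⟩
  have hzI : z ∈ Set.Icc (0 : ℝ) 1 := ⟨hz.le, hz1⟩
  have hs : t / z ∈ Set.Icc (0 : ℝ) 1 := ⟨div_nonneg ht.1 hz.le, (div_le_one hz).2 htz⟩
  have hspos : 0 < t / z := div_pos htpos hz
  obtain ⟨Y, hY0, hY1, hYe, hY⟩ := e.exists_det_of_meanEnt hs hzI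
  have hst : t / z * z = t := div_mul_cancel₀ t hz.ne'
  rw [← hYe]
  have hm := symmetricDet_mem hp hν hzI
  have hm0 := symmetricDet_mem hp h0 hzI
  have hmt := symmetricDet_mem hp hν ht
  have hmt0 := symmetricDet_mem hp h0 ht
  have hmul := symmetricDet_mul e.meanPopulation ν (t / z) z
  have hmul0 := symmetricDet_mul e.meanPopulation 0 (t / z) z
  rw [hst] at hmul hmul0 hY
  rw [← hνe] at hY
  simp only at hY
  refine monotoneOn_qubitEnt ⟨hY0, hY1.trans hm0.2⟩ hm ?_
  -- A larger determinant at level z would remain strictly larger after damping by t / z,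
  -- contradicting the equality of entropies at level t.
  by_contra hcon
  have hlt : symmetricDet e.meanPopulation ν t <
      t / z * Y + 4 * (t / z) * (1 - t / z) * (z * e.meanPopulation) ^ 2 := by
    rw [hmul]; linarith [mul_lt_mul_of_pos_left (not_le.1 hcon) hspos]
  have hle : t / z * Y + 4 * (t / z) * (1 - t / z) * (z * e.meanPopulation) ^ 2 ≤ 1 := by
    have := mul_le_mul_of_nonneg_left hY1 hspos.le
    linarith [hmt0.2]
  have := strictMonoOn_qubitEnt hmt ⟨hmt.1.trans hlt.le, hle⟩ hlt
  linarith

theorem qubitEnt_meanDet_le {η : ℝ} (h0 : 0 ≤ η) (h1 : η ≤ 1) :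
    qubitEnt (e.meanDet η) ≤ Real.binEntropy (η * e.meanPopulation) := by
  have hq : η * e.meanPopulation ∈ Set.Icc (0 : ℝ) 1 :=
    ⟨mul_nonneg h0 e.meanPopulation_mem.1,
      mul_le_one₀ h1 e.meanPopulation_mem.1 e.meanPopulation_mem.2⟩
  have hm := four_mul_mem hq
  have hle : e.meanDet η ≤ 4 * (η * e.meanPopulation) * (1 - η * e.meanPopulation) := by
    have := mul_nonneg h0 (Complex.normSq_nonneg e.meanCoherence)
    unfold meanDet; linarith
  -- Nonnegativity of `meanDet` need not be proved: for a negative value the argument of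
  -- `binEntropy` is at least 1, where it is nonpositive.
  rcases le_or_gt 0 (e.meanDet η) with h | h
  · rw [← qubitEnt_four_mul]
    exact monotoneOn_qubitEnt ⟨h, hle.trans hm.2⟩ hm hle
  · refine le_trans ?_ (Real.binEntropy_nonneg hq.1 hq.2)
    apply Real.binEntropy_nonpos_of_one_le
    have : 1 ≤ √(1 - e.meanDet η) := Real.one_le_sqrt.2 (by linarith)
    linarith

theorem exists_symmetric_bounds {η : ℝ} (h0 : 1 / 2 ≤ η) (h1 : η ≤ 1) :
    ∃ ν ∈ Set.Icc (0 : ℝ) 1,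
      mutualInfoAXB (e.cqState (amplitudeDamping η)) ≤
        h2 (η * e.meanPopulation) + gFun e.meanPopulation 1 ν - gFun e.meanPopulation (1 - η) ν ∧
      coherentInfo (e.cqState (amplitudeDamping η)) ≤
        gFun e.meanPopulation η ν - gFun e.meanPopulation (1 - η) ν ∧
      holevoInfo (e.cqState (amplitudeDamping η)) +
          coherentInfo (e.cqState (amplitudeDamping η)) ≤
        h2 (η * e.meanPopulation) - gFun e.meanPopulation (1 - η) ν := by
  have hη : 0 ≤ η := by linarith
  -- The matched level is that of the environment; η ≥ 1/2 places η above 1 - η.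
  obtain ⟨ν, hν, he, hz⟩ := e.exists_coherence (t := 1 - η) ⟨by linarith, by linarith⟩
  obtain ⟨i1, i2, i3⟩ := e.informations_cqState hη h1
  have hlog : 0 < Real.log 2 := Real.log_pos one_lt_two
  have hB := e.qubitEnt_meanDet_le hη h1
  have hA := hz 1 (by linarith) le_rfl one_pos
  have hη' := hz η (by linarith) h1 (by linarith)
  refine ⟨ν, hν, ?_, ?_, ?_⟩
  · rw [i1, h2_eq, gFun_eq_qubitEnt, gFun_eq_qubitEnt, ← he, ← add_div, ← sub_div]
    unfold meanEnt at hA ⊢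
    gcongr
  · rw [i2, gFun_eq_qubitEnt, gFun_eq_qubitEnt, ← he, ← sub_div]
    unfold meanEnt at hη' ⊢
    gcongr
  · rw [i3, h2_eq, gFun_eq_qubitEnt, ← he, ← sub_div]
    unfold meanEnt
    gcongr

end PureEnsemble

/-! ### Symmetric ensembles: exact values and existence -/

namespace PureEnsemble.IsSymmetric

variable {A : Type} [Fintype A] {e : PureEnsemble (Fin 2) A (Fin 2)} {p ν : ℝ}

theorem population_eq (h : e.IsSymmetric p ν) (x : Fin 2) : e.population x = p := by
  fin_cases x
  · simp [population, h.2.1, qubitState]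
  · simp [population, h.2.2, qubitState]

theorem levelDet_eq (h : e.IsSymmetric p ν) (hp : p ∈ Set.Icc (0 : ℝ) 1) (z : ℝ) (x : Fin 2) :
    e.levelDet z x = symmetricDet p ν z := by
  have hs : e.sqCoherence x = ν ^ 2 * (p * (1 - p)) := by
    have : √(p * (1 - p)) * √(p * (1 - p)) = p * (1 - p) :=
      Real.mul_self_sqrt (mul_nonneg hp.1 (by linarith [hp.2]))
    fin_cases x
    · simp only [sqCoherence, h.2.1, qubitState, Fin.zero_eta, Matrix.of_apply, Matrix.cons_val',
        Matrix.cons_val_zero, Matrix.cons_val_one, Matrix.cons_val_fin_one, Complex.normSq_ofReal]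
      linear_combination ν ^ 2 * this
    · simp only [sqCoherence, h.2.2, qubitState, Fin.mk_one, Matrix.of_apply, Matrix.cons_val',
        Matrix.cons_val_zero, Matrix.cons_val_one, Matrix.cons_val_fin_one, Complex.normSq_ofReal]
      linear_combination ν ^ 2 * this
  rw [levelDet, hs, h.population_eq, symmetricDet]

theorem meanDet_eq (h : e.IsSymmetric p ν) (η : ℝ) :
    e.meanDet η = 4 * (η * p) * (1 - η * p) := by
  have h1 : e.meanPopulation = p := by
    rw [meanPopulation, Fin.sum_univ_two, h.population_eq, h.population_eq, h.1, h.1]; ring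
  -- The opposite coherences have equal weights, so the mean output is diagonal.
  have h2 : e.meanCoherence = 0 := by
    rw [meanCoherence, Fin.sum_univ_two, h.1, h.1, h.2.1, h.2.2]
    simp [qubitState]
  rw [meanDet, h1, h2]
  simp

theorem informations_eq (h : e.IsSymmetric p ν) (hp : p ∈ Set.Icc (0 : ℝ) 1) {η : ℝ}
    (h0 : 0 ≤ η) (h1 : η ≤ 1) :
    mutualInfoAXB (e.cqState (amplitudeDamping η)) =
        h2 (η * p) + gFun p 1 ν - gFun p (1 - η) ν ∧
      coherentInfo (e.cqState (amplitudeDamping η)) = gFun p η ν - gFun p (1 - η) ν ∧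
      holevoInfo (e.cqState (amplitudeDamping η)) +
          coherentInfo (e.cqState (amplitudeDamping η)) = h2 (η * p) - gFun p (1 - η) ν := by
  obtain ⟨i1, i2, i3⟩ := e.informations_cqState h0 h1
  rw [i3, i1, i2]
  simp only [h.levelDet_eq hp, h.meanDet_eq, qubitEnt_four_mul, ← Finset.sum_mul, e.prob_sum,
    h2_eq, gFun_eq_qubitEnt]
  refine ⟨?_, ?_, ?_⟩ <;> ring

end PureEnsemble.IsSymmetric

theorem exists_isSymmetric {p ν : ℝ} (hp : p ∈ Set.Icc (0 : ℝ) 1) (hν : ν ∈ Set.Icc (0 : ℝ) 1) :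
    ∃ e : PureEnsemble (Fin 2) (Fin 2) (Fin 2), e.IsSymmetric p ν := by
  have hp1 : 0 ≤ 1 - p := by linarith [hp.2]
  have hν1 : 0 ≤ 1 - ν ^ 2 := by nlinarith [hν.1, hν.2]
  have e0 := Real.mul_self_sqrt hp.1
  have e1 := Real.mul_self_sqrt hp1
  have e2 := Real.mul_self_sqrt hν1
  have e3 : √(p * (1 - p)) = √p * √(1 - p) := Real.sqrt_mul hp.1 _
  let c : Fin 2 → ℝ := ![1, -1]
  have hc : ∀ x, c x * c x = 1 := by intro x; fin_cases x <;> simp [c]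
  -- The columns are the unnormalized reference vectors paired with |0⟩ and |1⟩: squared norms p and
  -- 1 - p, inner product ±ν√(p(1-p)).
  let M : Fin 2 → Matrix (Fin 2) (Fin 2) ℝ := fun x =>
    !![√p, c x * ν * √(1 - p); 0, √(1 - ν ^ 2) * √(1 - p)]
  have hM : ∀ x i j, ∑ a, M x a i * M x a j =
      !![p, c x * (ν * √(p * (1 - p))); c x * (ν * √(p * (1 - p))), 1 - p] i j := by
    intro x i j
    fin_cases i <;> fin_cases j <;> simp [M, Fin.sum_univ_two, e0, e3]
    · ring
    · ring
    · linear_combination (ν ^ 2 * (√(1 - p) * √(1 - p))) * hc x +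
        (√(1 - p) * √(1 - p)) * e2 + e1
  let e : PureEnsemble (Fin 2) (Fin 2) (Fin 2) :=
    { prob := fun _ => 1 / 2
      prob_nonneg := fun _ => by norm_num
      prob_sum := by simp
      vec := fun x s => (M x s.1 s.2 : ℂ)
      vec_norm := fun x => by
        rw [Fintype.sum_prod_type, Finset.sum_comm, Fin.sum_univ_two]
        have h0 := hM x 0 0
        have h1 := hM x 1 1
        simp only [Complex.norm_real, Real.norm_eq_abs, sq_abs]
        simp only [sq]
        rw [h0, h1]
        simp }
  have hin : ∀ x i j, e.inputState x i j =
      ((!![p, c x * (ν * √(p * (1 - p))); c x * (ν * √(p * (1 - p))), 1 - p] i j : ℝ) : ℂ) := by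
    intro x i j
    rw [e.inputState_apply, ← hM x i j]
    push_cast
    exact Finset.sum_congr rfl fun a _ => by simp [e]
  refine ⟨e, fun _ => rfl, ?_, ?_⟩
  · ext i j
    rw [hin]
    fin_cases i <;> fin_cases j <;> simp [qubitState, c]
  · ext i j
    rw [hin]
    fin_cases i <;> fin_cases j <;> simp [qubitState, c]

/-! ### Equality of the regions -/

theorem ratePolyhedron_mono {a b c a' b' c' : ℝ} (ha : a ≤ a') (hb : b ≤ b') (hc : c ≤ c') :
    ratePolyhedron a b c ⊆ ratePolyhedron a' b' c' :=
  fun _ h => ⟨h.1.trans ha, h.2.1.trans hb, h.2.2.trans hc⟩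

theorem mainTheorem5 (η : ℝ) (hη : 1 / 2 ≤ η) (hη1 : η ≤ 1) :
    tripleTradeoffRegion (amplitudeDamping η) =
        (⋃ p ∈ Set.Icc (0 : ℝ) 1, ⋃ ν ∈ Set.Icc (0 : ℝ) 1,
          ratePolyhedron
            (h2 (η * p) + gFun p 1 ν - gFun p (1 - η) ν)
            (gFun p η ν - gFun p (1 - η) ν)
            (h2 (η * p) - gFun p (1 - η) ν)) ∧
      (∀ p ∈ Set.Icc (0 : ℝ) 1, ∀ ν ∈ Set.Icc (0 : ℝ) 1,
        (∃ (d : ℕ) (e : PureEnsemble (Fin 2) (Fin d) (Fin 2)), e.IsSymmetric p ν) ∧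
        ∀ (d : ℕ) (e : PureEnsemble (Fin 2) (Fin d) (Fin 2)), e.IsSymmetric p ν →
          mutualInfoAXB (e.cqState (amplitudeDamping η)) =
              h2 (η * p) + gFun p 1 ν - gFun p (1 - η) ν ∧
          coherentInfo (e.cqState (amplitudeDamping η)) =
              gFun p η ν - gFun p (1 - η) ν ∧
          holevoInfo (e.cqState (amplitudeDamping η)) +
                coherentInfo (e.cqState (amplitudeDamping η)) =
              h2 (η * p) - gFun p (1 - η) ν) ∧
      tripleTradeoffRegion (amplitudeDamping η) =
        (⋃ p ∈ Set.Icc (0 : ℝ) 1, ⋃ ν ∈ Set.Icc (0 : ℝ) 1,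
          ⋃ (d : ℕ) (e : PureEnsemble (Fin 2) (Fin d) (Fin 2)) (_ : e.IsSymmetric p ν),
            e.polyhedron (amplitudeDamping η)) := by

  have hη0 : 0 ≤ η := by linarith
  have hpoly : ∀ p ∈ Set.Icc (0 : ℝ) 1, ∀ ν : ℝ, ∀ (d : ℕ)
      (e : PureEnsemble (Fin 2) (Fin d) (Fin 2)), e.IsSymmetric p ν →
      e.polyhedron (amplitudeDamping η) = ratePolyhedron
        (h2 (η * p) + gFun p 1 ν - gFun p (1 - η) ν)
        (gFun p η ν - gFun p (1 - η) ν)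
        (h2 (η * p) - gFun p (1 - η) ν) := by
    intro p hp ν d e he
    obtain ⟨i1, i2, i3⟩ := he.informations_eq hp hη0 hη1
    rw [PureEnsemble.polyhedron, i3, i1, i2]
  have hregion : tripleTradeoffRegion (amplitudeDamping η) =
      (⋃ p ∈ Set.Icc (0 : ℝ) 1, ⋃ ν ∈ Set.Icc (0 : ℝ) 1,
        ratePolyhedron
          (h2 (η * p) + gFun p 1 ν - gFun p (1 - η) ν)
          (gFun p η ν - gFun p (1 - η) ν)
          (h2 (η * p) - gFun p (1 - η) ν)) := by
    apply Set.Subset.antisymm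
    · refine Set.iUnion_subset fun n => Set.iUnion_subset fun d => Set.iUnion_subset fun e => ?_
      obtain ⟨ν, hν, b1, b2, b3⟩ := e.exists_symmetric_bounds hη hη1
      -- The parameter p is the mean population of the given ensemble, and its polyhedron lies
      -- inside the one for (p, ν).
      refine (ratePolyhedron_mono b1 b2 b3).trans ?_
      exact Set.subset_iUnion₂_of_subset e.meanPopulation e.meanPopulation_mem
        (Set.subset_iUnion₂_of_subset ν hν subset_rfl)
    · refine Set.iUnion₂_subset fun p hp => Set.iUnion₂_subset fun ν hν => ?_
      obtain ⟨e, he⟩ := exists_isSymmetric hp hν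
      rw [← hpoly p hp ν 2 e he]
      exact Set.subset_iUnion_of_subset 2 (Set.subset_iUnion_of_subset 2
        (Set.subset_iUnion_of_subset e subset_rfl))
  refine ⟨hregion, fun p hp ν hν => ⟨?_, fun d e he => he.informations_eq hp hη0 hη1⟩, ?_⟩
  · obtain ⟨e, he⟩ := exists_isSymmetric hp hν
    exact ⟨2, e, he⟩
  · rw [hregion]
    refine Set.iUnion₂_congr fun p hp => Set.iUnion₂_congr fun ν hν => ?_
    apply Set.Subset.antisymm
    · obtain ⟨e, he⟩ := exists_isSymmetric hp hν
      rw [← hpoly p hp ν 2 e he]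
      exact Set.subset_iUnion_of_subset 2 (Set.subset_iUnion₂_of_subset e he subset_rfl)
    · refine Set.iUnion_subset fun d => Set.iUnion₂_subset fun e he => ?_
      rw [hpoly p hp ν d e he]
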